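/- A graph is called strongly regular with parameters $(v,k,\lambda,\mu)$ if it is neither complete nor edgeless, has $v$ vertices, is regular of valency $k$, any two adjacent vertices have exactly $\lambda$ common neighbours and any two distinct nonadjacent vertices have exactly $\mu$ common neighbours. For a subset $D$ of an abelian group $G$ with $0\notin D$ and $-D=D$, the Cayley graph $\mathrm{Cay}(G,D)$ has vertex set $G$, with $x,y$ adjacent if and only if $x-y\in D$. For $|G|=u^2$ and an integer $c\ge 0$, say that $D$ is of Latin square type with parameter $c$ if $0\notin D$, $-D=D$ and $\mathrm{Cay}(G,D)$ is strongly regular with parameters $$(u^2,\ c(u-1),\ u+c^2-3c,\ c^2-c),$$ where in the two degenerate cases $c=0$ and $c=u+1$ (valency $0$ and $u^2-1$) this is to be read as: $\mathrm{Cay}(G,D)$ is the edgeless graph, respectively the complete graph. **Theorem 1.4.** Let $m$ and $s$ be positive integers and let $q_1,\dots,q_s$ be prime powers with $2m\mid q_i+1$ for all $i$. Let $G_i$ be an elementary abelian group of order $q_i^4$ for $i=1,\dots,s$, and put $G=G_1\times\cdots\times G_s$ and $u=q_1^2q_2^2\cdots q_s^2$. Then $m\mid u-1$, and there are subsets $T_{y_1,y_2}\subseteq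 G\setminus\{0\}$, $y_1,y_2\in\mathbb{Z}/m$, with the following properties. * Each $T_{y_1,y_2}$ is of Latin square type with parameter $\frac{u-1}{m}+\delta$, where $\delta\in\{0,1,2\}$ is the number of indices $k\in\{1,2\}$ with $y_k=0$. * For each $y_2\in\mathbb{Z}/m$, the sets $T_{y_1,y_1+y_2}$, $y_1\in\mathbb{Z}/m$, partition $G\setminus\{0\}$; that is, their Cayley graphs decompose the complete graph $K_{u^2}$ on $G$. * For each integer $c$ of one of the forms 1. $c=(i+j)\frac{u-1}{m}+j$ with $0\le i\le m-2$ and $j\in\{0,1,2\}$, 2. $c=(j+i)\frac{u-1}{m}+2j$ with $0\le i\le m-1$ and $j\in\{0,1\}$, there are $y_2\in\mathbb{Z}/m$ and $Y\subseteq\mathbb{Z}/m$ such that $\bigcup_{y\in Y}T_{y,y+y_2}$ is of Latin square type with parameter $c$. In particular, for every such $c$ with $c\notin\{0,u+1\}$, there is a strongly regular Cayley graph on $G$ with Latin square type parameters $(u^2,c(u-1),u+c^2-3c,c^2-c)$. -/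

import Mathlib

/-- `A` is an elementary abelian group: all its elements are killed by one and the same prime. -/
def IsElementaryAbelian (A : Type*) [AddCommGroup A] : Prop :=
  ∃ p : ℕ, p.Prime ∧ ∀ a : A, p • a = 0

/-- `D` can serve as the connection set of a Cayley graph: `0 ∉ D` and `-D = D`. For such `D`,
distinct `x`, `y` are adjacent in `SimpleGraph.addCayley D` if and only if `x - y ∈ D`. -/
def IsConnectionSet {A : Type*} [AddCommGroup A] (D : Set A) : Prop :=
  (0 : A) ∉ D ∧ ∀ d ∈ D, -d ∈ D

open Classical in
/-- `Γ` is strongly regular with parameters `(v, k, ℓ, μ)`; it is neither edgeless nor complete. -/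
def IsStronglyRegular {V : Type*} [Fintype V] (Γ : SimpleGraph V) (v k ℓ μ : ℕ) : Prop :=
  Γ ≠ ⊥ ∧ Γ ≠ ⊤ ∧ Γ.IsSRGWith v k ℓ μ

/-- `Γ` is strongly regular with the Latin square type parameters
`(u², c(u-1), u+c²-3c, c²-c)`. The parameters are evaluated in the integers. -/
def IsLatinSquareSRG {V : Type*} [Fintype V] (Γ : SimpleGraph V) (u c : ℕ) : Prop :=
  ∃ k ℓ μ : ℕ, (k : ℤ) = c * ((u : ℤ) - 1) ∧ (ℓ : ℤ) = u + (c : ℤ) ^ 2 - 3 * c ∧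
    (μ : ℤ) = (c : ℤ) ^ 2 - c ∧ IsStronglyRegular Γ (u ^ 2) k ℓ μ

/-- `D` is a connection set whose Cayley graph is strongly regular of Latin square type with
parameter `c`. In the two extreme cases `c = 0` (valency `0`) and `c = u + 1` (valency `u² - 1`)
the Cayley graph is the edgeless, respectively the complete, graph instead. -/
def IsLatinSquareConnectionSet {A : Type*} [AddCommGroup A] [Fintype A] (D : Set A)
    (u c : ℕ) : Prop :=
  IsConnectionSet D ∧
    (c = 0 → SimpleGraph.addCayley D = ⊥) ∧
    (c = u + 1 → SimpleGraph.addCayley D = ⊤) ∧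
    (c ≠ 0 → c ≠ u + 1 → IsLatinSquareSRG (SimpleGraph.addCayley D) u c)

/-!
Sets of Latin square type are detected by the Fourier transform: a symmetric set `D` with
`c * (u - 1)` elements in a group of order `u ^ 2` is of Latin square type with parameter `c` as
soon as its nontrivial Fourier coefficients lie in `{u - c, -c}`
(`isLatinSquareConnectionSet_of_fourierSum`). All sets needed are unions of classes of a colouring
of the nonzero elements by `ZMod m`, and the condition on the coefficients says that, for every
nontrivial character `χ` of the colours, the transform of `χ ∘ colour` is `u` times a function of
the same kind. A suitable value at the origin makes this also hold at the trivial character.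

The nonzero elements are split into two types, and `p_b` denotes `χ ∘ α` on the points of type `b`,
with value `1` at the origin. The set `T y₁ y₂` consists of the points of the first type with
colour `y₁` and those of the second type with colour `y₂`. For fixed `d = y₂ - y₁` these are the
colour classes belonging to the function `p_true + χ (-d) * p_false`, whose value `1 + χ (-d)` at
the origin accounts for the additional contributions to the parameter at the colours `0` and `-d`
(`PairedColoring.isLatinSquareConnectionSet_colorClass`).

Such colourings alone cannot be composed along products of groups, since `p_b ⊗ p_b` vanishes on
the pairs of nonzero points of different types. So a second colouring `β` is carried along, whose
functions `r_b` vanish at the origin and are multiplied by `-u` under the Fourier transform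
(negative Latin square type). Then `p_b ⊗ p_b + r_b ⊗ r_{!b}` and `p_b ⊗ r_b + r_b ⊗ p_{!b}` are
again functions of the two kinds (`PairedColoring.prod`); the sign `-u` occurs twice in `r ⊗ r` and
once in the mixed terms.

For a single factor, the group is the additive group of a field `L` of order `q ^ 4`, with subfield
`K` of order `q ^ 2`, and the types are the squares and the nonsquares. Both are unions of
lines over `K`, which are coloured by `α`; a nontrivial character is trivial on exactly one line
(`exists_classSum_eq_of_sq`). Both are also unions of the sets of elements whose norm to `K` lies on
a given line of `K` over the field of order `q`. These elliptic quadrics are coloured by `β`; their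
transform is computed by completing the square in the norm form (`sum_addChar_trace_sub_norm`,
`exists_classSum_norm_eq`). There are `q + 1` quadrics, half of them squares, and `2 * m ∣ q + 1`
lets the `m` colours be equally distributed.
-/

open Finset

/-! ### Fourier sums and strongly regular Cayley graphs -/

/-- The unnormalised Fourier transform of a function on a finite abelian group. -/
noncomputable def fourierSum {A : Type*} [AddCommGroup A] [Fintype A] (f : A → ℂ)
    (ψ : AddChar A ℂ) : ℂ :=
  ∑ x, ψ x * f x

section Fourier

variable {A : Type*} [AddCommGroup A] [Fintype A]

theorem sum_mul_fourierSum (f : A → ℂ) (z : A) :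
    ∑ ψ : AddChar A ℂ, ψ (-z) * fourierSum f ψ = Fintype.card A * f z := by
  classical
  simp only [fourierSum, mul_sum]
  rw [sum_comm]
  have : ∀ x : A, ∑ ψ : AddChar A ℂ, ψ (-z) * (ψ x * f x)
      = (if x = z then (Fintype.card A : ℂ) else 0) * f x := by
    intro x
    have h := AddChar.sum_apply_eq_ite (x - z)
    rw [sub_eq_zero] at h
    rw [← h, sum_mul]
    refine sum_congr rfl fun ψ _ => ?_
    rw [sub_eq_add_neg, AddChar.map_add_eq_mul]
    ring
  simp [this]

theorem eq_of_fourierSum_eq {f g : A → ℂ} (h : ∀ ψ, fourierSum f ψ = fourierSum g ψ) : f = g := by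
  funext z
  have hA : (Fintype.card A : ℂ) ≠ 0 := Nat.cast_ne_zero.2 Fintype.card_ne_zero
  apply mul_left_cancel₀ hA
  rw [← sum_mul_fourierSum, ← sum_mul_fourierSum]
  simp only [h]

theorem fourierSum_convolution (f : A → ℂ) (ψ : AddChar A ℂ) :
    fourierSum (fun z => ∑ x, f x * f (z - x)) ψ = fourierSum f ψ ^ 2 := by
  simp only [fourierSum, sq, mul_sum, sum_mul]
  rw [sum_comm]
  conv_rhs => rw [sum_comm]
  refine sum_congr rfl fun x _ => ?_
  refine Fintype.sum_equiv (Equiv.subRight x) _ _ fun z => ?_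
  have : ψ z = ψ (z - x) * ψ x := by rw [← AddChar.map_add_eq_mul]; simp
  simp only [Equiv.subRight_apply, this]
  ring

open Classical in
/-- A set whose nontrivial Fourier coefficients take only the two values `u - c` and
`-c` has the convolution square predicted by the Latin square type parameters. -/
theorem indicator_convolution {D : Set A} {u c : ℕ} (hcard : Fintype.card A = u ^ 2)
    (hsize : fourierSum (fun x => if x ∈ D then (1 : ℂ) else 0) 0 = c * (u - 1))
    (hval : ∀ ψ : AddChar A ℂ, ψ ≠ 0 →
      fourierSum (fun x => if x ∈ D then (1 : ℂ) else 0) ψ = u - c ∨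
      fourierSum (fun x => if x ∈ D then (1 : ℂ) else 0) ψ = -c) (z : A) :
    ∑ x, (if x ∈ D then (1 : ℂ) else 0) * (if z - x ∈ D then (1 : ℂ) else 0) =
      (u - 2 * c) * (if z ∈ D then 1 else 0) + c * (u - c) * (if z = 0 then 1 else 0)
        + (c ^ 2 - c) := by
  set h : A → ℂ := fun x => if x ∈ D then (1 : ℂ) else 0
  suffices H : (fun z => ∑ x, h x * h (z - x)) = fun z =>
      (u - 2 * c) * h z + c * (u - c) * (if z = 0 then 1 else 0) + ((c : ℂ) ^ 2 - c) from
    congrFun H z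
  refine eq_of_fourierSum_eq fun ψ => ?_
  rw [fourierSum_convolution]
  have hR : fourierSum (fun z => (u - 2 * c) * h z + c * (u - c) * (if z = 0 then 1 else 0)
      + ((c : ℂ) ^ 2 - c)) ψ = (u - 2 * c) * fourierSum h ψ + c * (u - c)
        + (c ^ 2 - c) * (if ψ = 0 then (u : ℂ) ^ 2 else 0) := by
    have hψ := AddChar.sum_eq_ite ψ
    rw [hcard] at hψ
    push_cast at hψ
    rw [← hψ]
    simp only [fourierSum, mul_add, sum_add_distrib]
    congr 1
    · congr 1
      · rw [mul_sum]
        exact sum_congr rfl fun _ _ => by ring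
      · simp
    · rw [mul_sum]
      exact sum_congr rfl fun _ _ => by ring
  rw [hR]
  by_cases hψ : ψ = 0
  · subst hψ
    rw [hsize, if_pos rfl]
    ring
  · rw [if_neg hψ]
    rcases hval ψ hψ with e | e <;> rw [e] <;> ring

theorem IsConnectionSet.addCayley_adj_iff {A : Type*} [AddCommGroup A] {D : Set A}
    (hD : IsConnectionSet D) (x y : A) :
    (SimpleGraph.addCayley D).Adj x y ↔ x - y ∈ D := by
  rw [SimpleGraph.addCayley_adj]
  constructor
  · rintro ⟨-, h | h⟩
    · have := hD.2 _ h
      rwa [neg_add, neg_neg, ← sub_eq_add_neg] at this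
    · rwa [neg_add_eq_sub] at h
  · intro h
    refine ⟨?_, Or.inr (by rwa [neg_add_eq_sub])⟩
    rintro rfl
    exact hD.1 (by simpa using h)

theorem isStronglyRegular_of_ncard {V : Type*} [Fintype V] {Γ : SimpleGraph V} {v k l e : ℕ}
    (hbot : Γ ≠ ⊥) (htop : Γ ≠ ⊤) (hcard : Fintype.card V = v)
    (hk : ∀ x, (Γ.neighborSet x).ncard = k)
    (hl : ∀ x y, Γ.Adj x y → (Γ.commonNeighbors x y).ncard = l)
    (he : ∀ x y, x ≠ y → ¬ Γ.Adj x y → (Γ.commonNeighbors x y).ncard = e) :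
    IsStronglyRegular Γ v k l e := by
  classical
  refine ⟨hbot, htop, hcard, fun x => ?_, fun x y h => ?_, fun x y hne h => ?_⟩
  · rw [← SimpleGraph.card_neighborSet_eq_degree, Fintype.card_eq_nat_card,
      Nat.card_coe_set_eq, hk]
  · rw [Fintype.card_eq_nat_card, Nat.card_coe_set_eq, hl x y h]
  · rw [Fintype.card_eq_nat_card, Nat.card_coe_set_eq, he x y hne h]

/-- The Fourier-analytic criterion for being of Latin square type. -/
theorem isLatinSquareConnectionSet_of_fourierSum {D : Set A} {u c : ℕ} (hu : 1 < u)
    (hcard : Fintype.card A = u ^ 2) (hD : IsConnectionSet D)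
    (hsize : D.ncard = c * (u - 1))
    (hval : ∀ ψ : AddChar A ℂ, ψ ≠ 0 →
      fourierSum (D.indicator 1) ψ = u - c ∨ fourierSum (D.indicator 1) ψ = -c) :
    IsLatinSquareConnectionSet D u c := by
  classical
  have hadj := hD.addCayley_adj_iff
  have hind : (D.indicator 1 : A → ℂ) = fun x => if x ∈ D then (1 : ℂ) else 0 := by
    funext x; simp [Set.indicator_apply]
  rw [hind] at hval
  have hncard : D.ncard = #{x | x ∈ D} := by
    rw [Set.ncard_eq_toFinset_card']; congr 1; ext; simp
  have hsize' : fourierSum (fun x => if x ∈ D then (1 : ℂ) else 0) 0 = c * (u - 1) := by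
    simp only [fourierSum, AddChar.zero_apply, one_mul, sum_boole]
    rw [← hncard, hsize]
    push_cast [Nat.cast_sub hu.le]
    ring
  have hconv := indicator_convolution hcard hsize' hval
  have hcompl : ({0}ᶜ : Set A).ncard = (u + 1) * (u - 1) := by
    have h := Set.ncard_add_ncard_compl ({0} : Set A)
    rw [Set.ncard_singleton, Nat.card_eq_fintype_card, hcard] at h
    obtain ⟨w, rfl⟩ : ∃ w, u = w + 1 := ⟨u - 1, by omega⟩
    simp only [Nat.add_sub_cancel]
    nlinarith
  have hsub : D ⊆ {0}ᶜ := fun x hx h0 => hD.1 (by rw [← Set.mem_singleton_iff.1 h0]; exact hx)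
  have hpos : 0 < u - 1 := by omega
  refine ⟨hD, fun hc => ?_, fun hc => ?_, fun hc0 hc1 => ?_⟩
  · have : D = ∅ := by
      rw [← Set.ncard_eq_zero, hsize, hc, zero_mul]
    rw [this, SimpleGraph.addCayley_empty]
  · have : D = {0}ᶜ := Set.eq_of_subset_of_ncard_le hsub (by rw [hcompl, hsize, hc])
    ext x y
    rw [hadj, this, SimpleGraph.top_adj]
    simp [sub_eq_zero]
  -- the number of common neighbours of `v` and `w` is the convolution square at `v - w`
  have hcommon : ∀ v w : A,
      (((SimpleGraph.addCayley D).commonNeighbors v w).ncard : ℂ) =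
      (u - 2 * c) * (if v - w ∈ D then 1 else 0) + c * (u - c) * (if v - w = 0 then 1 else 0)
        + (c ^ 2 - c) := by
    intro v w
    rw [← hconv (v - w)]
    simp only [← ite_and, mul_ite, mul_one, mul_zero, sum_boole]
    rw [Set.ncard_eq_toFinset_card']
    congr 1
    refine card_bij (fun x _ => v - x) ?_ ?_ ?_
    · intro x hx
      rw [Set.mem_toFinset, SimpleGraph.mem_commonNeighbors, hadj, hadj] at hx
      refine mem_filter.2 ⟨mem_univ _, ?_, hx.1⟩
      have := hD.2 _ hx.2
      rwa [show v - w - (v - x) = -(w - x) by abel]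
    · intro x _ y _ h
      exact sub_right_injective h
    · intro y hy
      have hy := (mem_filter.1 hy).2
      refine ⟨v - y, ?_, by abel⟩
      rw [Set.mem_toFinset, SimpleGraph.mem_commonNeighbors, hadj, hadj]
      refine ⟨by simpa using hy.2, ?_⟩
      have := hD.2 _ hy.1
      rwa [show w - (v - y) = -(v - w - y) by abel]
  have hbot : SimpleGraph.addCayley D ≠ ⊥ := by
    intro h
    have : D = ∅ := by
      rw [Set.eq_empty_iff_forall_notMem]
      intro x hx
      have : (SimpleGraph.addCayley D).Adj x 0 := by rw [hadj]; simpa using hx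
      rw [h] at this
      exact this
    rw [this, Set.ncard_empty] at hsize
    rcases mul_eq_zero.1 hsize.symm with h | h <;> omega
  have htop : SimpleGraph.addCayley D ≠ ⊤ := by
    intro h
    have : D = {0}ᶜ := by
      refine hsub.antisymm fun x hx => ?_
      have : (SimpleGraph.addCayley D).Adj x 0 := by
        rw [h]; exact hx
      rw [hadj] at this
      simpa using this
    rw [this, hcompl] at hsize
    exact hc1 (Nat.eq_of_mul_eq_mul_right hpos hsize).symm
  obtain ⟨l, hl⟩ : ∃ l : ℕ, (l : ℤ) = u + (c : ℤ) ^ 2 - 3 * c :=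
    ⟨((u : ℤ) + (c : ℤ) ^ 2 - 3 * c).toNat, Int.toNat_of_nonneg (by
      have : (2 : ℤ) ≤ u := by exact_mod_cast hu
      nlinarith [sq_nonneg ((c : ℤ) - 1), sq_nonneg ((c : ℤ) - 2),
        show (0 : ℤ) ≤ ((c : ℤ) - 1) * (c - 2) by
          rcases Nat.lt_or_ge c 2 with h | h
          · have : c = 1 := by omega
            simp [this]
          · have : (2 : ℤ) ≤ c := by exact_mod_cast h
            exact mul_nonneg (by linarith) (by linarith)])⟩
  obtain ⟨e, he⟩ : ∃ e : ℕ, (e : ℤ) = (c : ℤ) ^ 2 - c :=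
    ⟨((c : ℤ) ^ 2 - c).toNat, Int.toNat_of_nonneg (by
      have : (1 : ℤ) ≤ c := by exact_mod_cast Nat.one_le_iff_ne_zero.2 hc0
      nlinarith)⟩
  have hl' : (l : ℂ) = u + (c : ℂ) ^ 2 - 3 * c := by exact_mod_cast congrArg (Int.cast : ℤ → ℂ) hl
  have he' : (e : ℂ) = (c : ℂ) ^ 2 - c := by exact_mod_cast congrArg (Int.cast : ℤ → ℂ) he
  refine ⟨c * (u - 1), l, e, by push_cast [Nat.cast_sub hu.le]; ring, hl, he,
    isStronglyRegular_of_ncard hbot htop hcard ?_ ?_ ?_⟩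
  · intro v
    rw [← hsize]
    refine Set.ncard_congr (fun x _ => v - x) ?_ ?_ ?_
    · intro x hx
      rwa [SimpleGraph.mem_neighborSet, hadj] at hx
    · intro x y _ _ h
      exact sub_right_injective h
    · intro y hy
      refine ⟨v - y, ?_, by abel⟩
      rw [SimpleGraph.mem_neighborSet, hadj]
      simpa using hy
  · intro v w hvw
    have hne : v - w ≠ 0 := sub_ne_zero.2 hvw.ne
    rw [hadj] at hvw
    have h := hcommon v w
    rw [if_pos hvw, if_neg hne] at h
    have : (((SimpleGraph.addCayley D).commonNeighbors v w).ncard : ℂ) = l := by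
      rw [h, hl']; ring
    exact_mod_cast this
  · intro v w hne hvw
    have hne : v - w ≠ 0 := sub_ne_zero.2 hne
    rw [hadj] at hvw
    have h := hcommon v w
    rw [if_neg hvw, if_neg hne] at h
    have : (((SimpleGraph.addCayley D).commonNeighbors v w).ncard : ℂ) = e := by
      rw [h, he']; ring
    exact_mod_cast this

end Fourier

/-! ### Paired colourings -/

/-- The complex function attached to a two-valued type map `τ`, a colouring `α` and a character
`χ` of the colours: it is `χ ∘ α` on the nonzero points of type `b`, zero on those of the other
type, and has the prescribed value `z` at the origin. -/
noncomputable def colorFun {B : Type*} [Zero B] {m : ℕ} (χ : AddChar (ZMod m) ℂ) (z : ℂ)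
    (b : Bool) (τ : B → Bool) (α : B → ZMod m) (x : B) : ℂ :=
  open Classical in if x = 0 then z else if τ x = b then χ (α x) else 0

/-- Two colourings `α`, `β` of the nonzero elements of a group of order `u ^ 2`, together with a
partition of these elements into two types, such that on each type the colour classes of `α`
behave like sets of Latin square type (the Fourier transform multiplies by `u`) and those of `β`
like sets of negative Latin square type (it multiplies by `-u`). The maps with subscript `dual`
describe the Fourier transforms, on the nontrivial characters of the group. The points of type `b`
correspond to characters of type `b` for `α`, but of the opposite type for `β`. The values of all
maps at the origin are irrelevant. -/
structure PairedColoring (m u : ℕ) (A : Type*) [AddCommGroup A] [Fintype A] where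
  /-- the type of a point -/
  τ : A → Bool
  /-- the colouring of Latin square type -/
  α : A → ZMod m
  /-- the colouring of negative Latin square type -/
  β : A → ZMod m
  /-- the type of a character -/
  τdual : AddChar A ℂ → Bool
  /-- the dual of `α` -/
  αdual : AddChar A ℂ → ZMod m
  /-- the dual of `β` -/
  βdual : AddChar A ℂ → ZMod m
  card_eq : Fintype.card A = u ^ 2
  τ_neg : ∀ x, τ (-x) = τ x
  α_neg : ∀ x, α (-x) = α x
  β_neg : ∀ x, β (-x) = β x
  fourierSum_α : ∀ χ : AddChar (ZMod m) ℂ, χ ≠ 0 → ∀ b ψ,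
    fourierSum (colorFun χ 1 b τ α) ψ = u * colorFun χ 1 b τdual αdual ψ
  fourierSum_β : ∀ χ : AddChar (ZMod m) ℂ, χ ≠ 0 → ∀ b ψ,
    fourierSum (colorFun χ 0 b τ β) ψ = -u * colorFun χ 0 (!b) τdual βdual ψ

theorem AddChar.eq_zero_iff_prod {A B : Type*} [AddCommGroup A] [AddCommGroup B]
    (ψ : AddChar (A × B) ℂ) :
    ψ = 0 ↔ ψ.compAddMonoidHom (AddMonoidHom.inl A B) = 0 ∧
      ψ.compAddMonoidHom (AddMonoidHom.inr A B) = 0 := by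
  constructor
  · rintro rfl
    exact ⟨by ext; simp, by ext; simp⟩
  · rintro ⟨h1, h2⟩
    ext ⟨a, b⟩
    have h1 := DFunLike.congr_fun h1 a
    have h2 := DFunLike.congr_fun h2 b
    simp only [AddChar.compAddMonoidHom_apply, AddMonoidHom.inl_apply, AddMonoidHom.inr_apply,
      AddChar.zero_apply] at h1 h2
    rw [show ((a, b) : A × B) = (a, 0) + (0, b) by simp, AddChar.map_add_eq_mul, h1, h2]
    simp

/-- The Fourier transform of a product function on a product group factors. -/
theorem fourierSum_prod {A B : Type*} [AddCommGroup A] [AddCommGroup B] [Fintype A] [Fintype B]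
    (f : A → ℂ) (g : B → ℂ) (ψ : AddChar (A × B) ℂ) :
    fourierSum (fun x : A × B => f x.1 * g x.2) ψ =
      fourierSum f (ψ.compAddMonoidHom (AddMonoidHom.inl A B)) *
      fourierSum g (ψ.compAddMonoidHom (AddMonoidHom.inr A B)) := by
  simp only [fourierSum, sum_mul_sum, Fintype.sum_prod_type]
  refine sum_congr rfl fun a _ => sum_congr rfl fun b _ => ?_
  rw [show ((a, b) : A × B) = (a, 0) + (0, b) by simp, AddChar.map_add_eq_mul]
  simp only [AddChar.compAddMonoidHom_apply, AddMonoidHom.inl_apply, AddMonoidHom.inr_apply]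
  ring

theorem fourierSum_add {A : Type*} [AddCommGroup A] [Fintype A]
    (f g : A → ℂ) (ψ : AddChar A ℂ) :
    fourierSum (fun x => f x + g x) ψ = fourierSum f ψ + fourierSum g ψ := by
  simp only [fourierSum, mul_add, sum_add_distrib]

namespace PairedColoring

open Classical in
/-- The composition of paired colourings. With `p_b`, `r_b` the functions attached to `α`, `β` on
the points of type `b`, the new functions are `p_b ⊗ p_b + r_b ⊗ r_{!b}` and
`p_b ⊗ r_b + r_b ⊗ p_{!b}`; the two terms of each have disjoint supports, and together the
supports exhaust all nonzero points. A new point has the type of its first coordinate. Since the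
transforms of `r_b` live on the opposite type, a new character has the type of its second
coordinate instead. -/
noncomputable def prod {m u v : ℕ} {A B : Type*} [AddCommGroup A] [AddCommGroup B] [Fintype A]
    [Fintype B] (S : PairedColoring m u A) (T : PairedColoring m v B) :
    PairedColoring m (u * v) (A × B) where
  τ x := if x.1 = 0 then T.τ x.2 else S.τ x.1
  α x := if x.1 = 0 then T.α x.2 else if x.2 = 0 then S.α x.1 else
    if S.τ x.1 = T.τ x.2 then S.α x.1 + T.α x.2 else S.β x.1 + T.β x.2
  β x := if x.1 = 0 then T.β x.2 else if x.2 = 0 then S.β x.1 else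
    if S.τ x.1 = T.τ x.2 then S.α x.1 + T.β x.2 else S.β x.1 + T.α x.2
  τdual ψ :=
    let φ := ψ.compAddMonoidHom (AddMonoidHom.inl A B)
    let θ := ψ.compAddMonoidHom (AddMonoidHom.inr A B)
    if θ = 0 then S.τdual φ else T.τdual θ
  αdual ψ :=
    let φ := ψ.compAddMonoidHom (AddMonoidHom.inl A B)
    let θ := ψ.compAddMonoidHom (AddMonoidHom.inr A B)
    if φ = 0 then T.αdual θ else if θ = 0 then S.αdual φ else
      if S.τdual φ = T.τdual θ then S.αdual φ + T.αdual θ else S.βdual φ + T.βdual θ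
  βdual ψ :=
    let φ := ψ.compAddMonoidHom (AddMonoidHom.inl A B)
    let θ := ψ.compAddMonoidHom (AddMonoidHom.inr A B)
    if φ = 0 then T.βdual θ else if θ = 0 then S.βdual φ else
      if S.τdual φ = T.τdual θ then S.βdual φ + T.αdual θ else S.αdual φ + T.βdual θ
  card_eq := by rw [Fintype.card_prod, S.card_eq, T.card_eq]; ring
  τ_neg x := by simp [S.τ_neg, T.τ_neg]
  α_neg x := by simp [S.τ_neg, T.τ_neg, S.α_neg, T.α_neg, S.β_neg, T.β_neg]
  β_neg x := by simp [S.τ_neg, T.τ_neg, S.α_neg, T.α_neg, S.β_neg, T.β_neg]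
  fourierSum_α χ hχ b ψ := by
    trans fourierSum (fun x : A × B =>
      colorFun χ 1 b S.τ S.α x.1 * colorFun χ 1 b T.τ T.α x.2 +
      colorFun χ 0 b S.τ S.β x.1 * colorFun χ 0 (!b) T.τ T.β x.2) ψ
    · congr 1
      funext ⟨x, y⟩
      simp only [colorFun, Prod.mk_eq_zero]
      by_cases hx : x = 0 <;> by_cases hy : y = 0 <;> simp only [hx, hy, if_true, if_false,
        and_true, and_false] <;> cases S.τ x <;> cases T.τ y <;> cases b <;>
        simp [AddChar.map_add_eq_mul]
    · rw [fourierSum_add, fourierSum_prod, fourierSum_prod, S.fourierSum_α χ hχ,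
        S.fourierSum_β χ hχ, T.fourierSum_α χ hχ, T.fourierSum_β χ hχ]
      simp only [colorFun, AddChar.eq_zero_iff_prod ψ]
      generalize ψ.compAddMonoidHom (AddMonoidHom.inl A B) = x
      generalize ψ.compAddMonoidHom (AddMonoidHom.inr A B) = y
      push_cast
      by_cases hx : x = 0 <;> by_cases hy : y = 0 <;> simp only [hx, hy, if_true, if_false,
        and_true, and_false] <;> cases S.τdual x <;> cases T.τdual y <;>
        cases b <;> simp [AddChar.map_add_eq_mul] <;> ring
  fourierSum_β χ hχ b ψ := by
    trans fourierSum (fun x : A × B =>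
      colorFun χ 1 b S.τ S.α x.1 * colorFun χ 0 b T.τ T.β x.2 +
      colorFun χ 0 b S.τ S.β x.1 * colorFun χ 1 (!b) T.τ T.α x.2) ψ
    · congr 1
      funext ⟨x, y⟩
      simp only [colorFun, Prod.mk_eq_zero]
      by_cases hx : x = 0 <;> by_cases hy : y = 0 <;> simp only [hx, hy, if_true, if_false,
        and_true, and_false] <;> cases S.τ x <;> cases T.τ y <;> cases b <;>
        simp [AddChar.map_add_eq_mul]
    · rw [fourierSum_add, fourierSum_prod, fourierSum_prod, S.fourierSum_α χ hχ,
        S.fourierSum_β χ hχ, T.fourierSum_α χ hχ, T.fourierSum_β χ hχ]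
      simp only [colorFun, AddChar.eq_zero_iff_prod ψ]
      generalize ψ.compAddMonoidHom (AddMonoidHom.inl A B) = x
      generalize ψ.compAddMonoidHom (AddMonoidHom.inr A B) = y
      push_cast
      by_cases hx : x = 0 <;> by_cases hy : y = 0 <;> simp only [hx, hy, if_true, if_false,
        and_true, and_false] <;> cases S.τdual x <;> cases T.τdual y <;>
        cases b <;> simp [AddChar.map_add_eq_mul] <;> ring

/-- Transport of a paired colouring along an isomorphism of groups. -/
def congr {m u : ℕ} {A B : Type*} [AddCommGroup A] [AddCommGroup B] [Fintype A] [Fintype B]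
    (e : B ≃+ A) (S : PairedColoring m u A) : PairedColoring m u B :=
  have hsum (f : A → ℂ) (ψ : AddChar B ℂ) : fourierSum (fun x => f (e x)) ψ =
      fourierSum f (ψ.compAddMonoidHom e.symm) :=
    Fintype.sum_equiv e.toEquiv _ _ fun x => by simp
  have hzero (ψ : AddChar B ℂ) : ψ.compAddMonoidHom (e.symm : A →+ B) = 0 ↔ ψ = 0 := by
    rw [AddChar.eq_zero_iff, AddChar.eq_zero_iff]
    exact ⟨fun h x => by simpa using h (e x), fun h x => by simpa using h (e.symm x)⟩
  { τ := fun x => S.τ (e x)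
    α := fun x => S.α (e x)
    β := fun x => S.β (e x)
    τdual := fun ψ => S.τdual (ψ.compAddMonoidHom e.symm)
    αdual := fun ψ => S.αdual (ψ.compAddMonoidHom e.symm)
    βdual := fun ψ => S.βdual (ψ.compAddMonoidHom e.symm)
    card_eq := (Fintype.card_congr e.toEquiv).trans S.card_eq
    τ_neg := fun x => by simp [S.τ_neg]
    α_neg := fun x => by simp [S.α_neg]
    β_neg := fun x => by simp [S.β_neg]
    fourierSum_α := fun χ hχ b ψ => by
      have h := S.fourierSum_α χ hχ b (ψ.compAddMonoidHom e.symm)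
      have hf : (fun x => colorFun χ 1 b S.τ S.α (e x)) =
          colorFun χ 1 b (fun x => S.τ (e x)) fun x => S.α (e x) := by
        funext x
        by_cases hx : x = 0
        · simp [colorFun, hx]
        · have hx' : e x ≠ 0 := by simpa using hx
          rw [colorFun, colorFun, if_neg hx, if_neg hx']
      rw [← hsum, hf] at h
      rw [h]
      simp only [colorFun, hzero]
    fourierSum_β := fun χ hχ b ψ => by
      have h := S.fourierSum_β χ hχ b (ψ.compAddMonoidHom e.symm)
      have hf : (fun x => colorFun χ 0 b S.τ S.β (e x)) =
          colorFun χ 0 b (fun x => S.τ (e x)) fun x => S.β (e x) := by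
        funext x
        by_cases hx : x = 0
        · simp [colorFun, hx]
        · have hx' : e x ≠ 0 := by simpa using hx
          rw [colorFun, colorFun, if_neg hx, if_neg hx']
      rw [← hsum, hf] at h
      rw [h]
      simp only [colorFun, hzero] }

/-- The trivial group carries the empty paired colouring. -/
def ofUnique (m : ℕ) (A : Type*) [AddCommGroup A] [Fintype A] [Subsingleton A] :
    PairedColoring m 1 A where
  τ _ := true
  α _ := 0
  β _ := 0
  τdual _ := true
  αdual _ := 0
  βdual _ := 0
  card_eq := by simp [Fintype.card_eq_one_iff, Subsingleton.elim _ (0 : A)]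
  τ_neg _ := rfl
  α_neg _ := rfl
  β_neg _ := rfl
  fourierSum_α χ hχ b ψ := by
    have hA : (univ : Finset A) = {0} := by ext; simp [Subsingleton.elim _ (0 : A)]
    have hψ : ψ = 0 := by
      rw [AddChar.eq_zero_iff]; intro x; rw [Subsingleton.elim x 0, AddChar.map_zero_eq_one]
    simp [fourierSum, hA, colorFun, hψ]
  fourierSum_β χ hχ b ψ := by
    have hA : (univ : Finset A) = {0} := by ext; simp [Subsingleton.elim _ (0 : A)]
    have hψ : ψ = 0 := by
      rw [AddChar.eq_zero_iff]; intro x; rw [Subsingleton.elim x 0, AddChar.map_zero_eq_one]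
    simp [fourierSum, hA, colorFun, hψ]

/-- A finite product of groups with paired colourings has a paired colouring. -/
theorem nonempty_pi {m : ℕ} : ∀ {s : ℕ} (u : Fin s → ℕ) (G : Fin s → Type*)
    [∀ i, AddCommGroup (G i)] [∀ i, Fintype (G i)],
    (∀ i, Nonempty (PairedColoring m (u i) (G i))) →
    Nonempty (PairedColoring m (∏ i, u i) (∀ i, G i))
  | 0, u, G, _, _, _ => by
    rw [Fin.prod_univ_zero]
    exact ⟨ofUnique m _⟩
  | s + 1, u, G, _, _, h => by
    obtain ⟨S⟩ := h 0
    obtain ⟨T⟩ := nonempty_pi (fun i => u i.succ) (fun i => G i.succ) fun i => h i.succ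
    rw [Fin.prod_univ_succ]
    let e : (∀ i, G i) ≃+ G 0 × ∀ i : Fin s, G i.succ :=
      { (Fin.consEquiv G).symm with
        map_add' := fun x y => rfl }
    exact ⟨(S.prod T).congr e⟩

end PairedColoring

/-! ### The connection sets of a paired colouring -/

theorem sum_addChar_zmod_mul {m : ℕ} [NeZero m] (a y : ZMod m) :
    ∑ χ : AddChar (ZMod m) ℂ, χ (-y) * χ a = m * if a = y then 1 else 0 := by
  have h := AddChar.sum_apply_eq_ite (a - y)
  simp only [sub_eq_zero, ZMod.card] at h
  rw [mul_ite, mul_one, mul_zero, ← h]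
  exact sum_congr rfl fun χ _ => by rw [← AddChar.map_add_eq_mul, neg_add_eq_sub]

namespace PairedColoring

variable {m u : ℕ} {A : Type*} [AddCommGroup A] [Fintype A]

/-- The colouring of the nonzero points which is `α` on the points of type `true` and the
translate `α - d` on those of type `false`. -/
def shiftedColor (S : PairedColoring m u A) (d : ZMod m) (x : A) : ZMod m :=
  if S.τ x then S.α x else S.α x - d

/-- The union of the classes of `shiftedColor` whose colours belong to `Y`. -/
def colorClass (S : PairedColoring m u A) (d : ZMod m) (Y : Finset (ZMod m)) : Set A :=
  {x | x ≠ 0 ∧ S.shiftedColor d x ∈ Y}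

theorem isConnectionSet_colorClass (S : PairedColoring m u A) (d : ZMod m)
    (Y : Finset (ZMod m)) : IsConnectionSet (S.colorClass d Y) :=
  ⟨fun h => h.1 rfl, fun x hx => ⟨neg_ne_zero.2 hx.1, by
    have := hx.2
    simpa only [shiftedColor, S.τ_neg, S.α_neg] using this⟩⟩

open Classical in
/-- The character `χ` of the colours applied to `shiftedColor` has, once its value at the origin
is set to `1 + χ (-d)`, a Fourier transform of the same shape. This is where the value at the
origin comes from: it is the sum of the contributions of the two types. -/
theorem fourierSum_shiftedColor (S : PairedColoring m u A) (d : ZMod m) (ψ : AddChar A ℂ)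
    {χ : AddChar (ZMod m) ℂ} (hχ : χ ≠ 0) :
    fourierSum (fun x => if x = 0 then 1 + χ (-d) else χ (S.shiftedColor d x)) ψ =
      u * if ψ = 0 then 1 + χ (-d) else
        χ (if S.τdual ψ then S.αdual ψ else S.αdual ψ - d) := by
  have key : ∀ (B : Type _) [Zero B] (τ : B → Bool) (α : B → ZMod m) (x : B),
      (if x = 0 then 1 + χ (-d) else χ (if τ x then α x else α x - d)) =
      colorFun χ 1 true τ α x + χ (-d) * colorFun χ 1 false τ α x := by
    intro B _ τ α x
    by_cases hx : x = 0
    · simp [colorFun, hx]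
    · cases h : τ x
      · simp [colorFun, hx, h, sub_eq_add_neg, AddChar.map_add_eq_mul, mul_comm]
      · simp [colorFun, hx, h]
  have hf : (fun x => if x = 0 then 1 + χ (-d) else χ (S.shiftedColor d x)) = fun x =>
      colorFun χ 1 true S.τ S.α x + χ (-d) * colorFun χ 1 false S.τ S.α x :=
    funext fun x => key A S.τ S.α x
  have hmul : fourierSum (fun x => χ (-d) * colorFun χ 1 false S.τ S.α x) ψ =
      χ (-d) * fourierSum (colorFun χ 1 false S.τ S.α) ψ := by
    simp only [fourierSum, mul_sum]
    exact sum_congr rfl fun _ _ => by ring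
  rw [hf, fourierSum_add, hmul, S.fourierSum_α χ hχ, S.fourierSum_α χ hχ, key _ S.τdual S.αdual ψ]
  ring

open Classical in
theorem card_mul_fourierSum_colorClass [NeZero m] (S : PairedColoring m u A) (d : ZMod m)
    (Y : Finset (ZMod m)) (ψ : AddChar A ℂ) :
    m * fourierSum ((S.colorClass d Y).indicator 1) ψ =
      ∑ y ∈ Y, ∑ χ : AddChar (ZMod m) ℂ, χ (-y) *
        (fourierSum (fun x => if x = 0 then 1 + χ (-d) else χ (S.shiftedColor d x)) ψ
          - (1 + χ (-d))) := by
  have hind : ∀ x, (m : ℂ) * (S.colorClass d Y).indicator 1 x =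
      ∑ y ∈ Y, ∑ χ : AddChar (ZMod m) ℂ, χ (-y) *
        (if x = 0 then 0 else χ (S.shiftedColor d x)) := by
    intro x
    by_cases hx : x = 0
    · simp [colorClass, hx]
    · simp only [hx, if_false, sum_addChar_zmod_mul, ← mul_sum]
      simp [colorClass, Set.indicator_apply, hx]
  have hsub : ∀ χ : AddChar (ZMod m) ℂ,
      fourierSum (fun x => if x = 0 then 1 + χ (-d) else χ (S.shiftedColor d x)) ψ
          - (1 + χ (-d)) = ∑ x, ψ x * if x = 0 then 0 else χ (S.shiftedColor d x) := by
    intro χ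
    have : ∀ x : A, (ψ x * if x = 0 then 1 + χ (-d) else χ (S.shiftedColor d x)) =
        (ψ x * if x = 0 then 0 else χ (S.shiftedColor d x)) +
          if x = 0 then 1 + χ (-d) else 0 := by
      intro x
      by_cases hx : x = 0 <;> simp [hx]
    simp only [fourierSum, this, sum_add_distrib]
    simp
  simp only [hsub]
  rw [fourierSum, mul_sum]
  simp only [mul_left_comm (m : ℂ), hind, mul_sum]
  rw [sum_comm]
  refine sum_congr rfl fun y _ => ?_
  rw [sum_comm]
  exact sum_congr rfl fun χ _ => sum_congr rfl fun x _ => by ring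

/-- Every union of classes of a shifted colouring is of Latin square type. The parameter counts
the colours, with an extra contribution from each of the two colours `0` and `-d`. -/
theorem isLatinSquareConnectionSet_colorClass [NeZero m] (S : PairedColoring m u A) (hu : 1 < u)
    (hmu : m ∣ u - 1) (d : ZMod m) (Y : Finset (ZMod m)) :
    IsLatinSquareConnectionSet (S.colorClass d Y) u
      (#Y * ((u - 1) / m) + (if 0 ∈ Y then 1 else 0) + if -d ∈ Y then 1 else 0) := by
  classical
  obtain ⟨r, hr⟩ := hmu
  have hm : 0 < m := NeZero.pos m
  have hm' : (m : ℂ) ≠ 0 := Nat.cast_ne_zero.2 hm.ne'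
  have hr' : (u - 1) / m = r := by rw [hr, Nat.mul_div_cancel_left _ hm]
  have hur : (u : ℂ) = m * r + 1 := by
    have : u = m * r + 1 := by omega
    exact_mod_cast this
  rw [hr']
  set c := #Y * r + (if 0 ∈ Y then 1 else 0) + if -d ∈ Y then 1 else 0 with hc
  have hc' : (c : ℂ) = ∑ y ∈ Y, ((r : ℂ) + (if 0 = y then 1 else 0) + if -d = y then 1 else 0) := by
    simp only [sum_add_distrib, hc]
    push_cast
    simp
  -- the colour of a nontrivial character
  set f : AddChar A ℂ → ZMod m := fun ψ => if S.τdual ψ then S.αdual ψ else S.αdual ψ - d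
  set κ : AddChar A ℂ → ℂ := fun ψ => if ψ = 0 then ((u : ℂ) - 1) ^ 2 else 1 - u with hκ
  -- the formula for the transform at nontrivial `χ` persists at `χ = 0` up to a constant
  have hF : ∀ (ψ : AddChar A ℂ) (χ : AddChar (ZMod m) ℂ),
      fourierSum (fun x => if x = 0 then 1 + χ (-d) else χ (S.shiftedColor d x)) ψ =
      u * (if ψ = 0 then 1 + χ (-d) else χ (f ψ)) + (if χ = 0 then κ ψ else 0) := by
    intro ψ χ
    by_cases hχ : χ = 0
    · subst hχ
      have h1 : fourierSum (fun x => if x = 0 then 1 + (0 : AddChar (ZMod m) ℂ) (-d) else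
          (0 : AddChar (ZMod m) ℂ) (S.shiftedColor d x)) ψ = 1 + ∑ x, ψ x := by
        have : ∀ x : A, (ψ x * if x = 0 then (1 + 1 : ℂ) else 1) =
            (if x = 0 then 1 else 0) + ψ x := by
          intro x
          by_cases hx : x = 0
          · simp [hx]
          · simp [hx]
        simp only [fourierSum, AddChar.zero_apply, this, sum_add_distrib]
        simp
      rw [h1, AddChar.sum_eq_ite, S.card_eq]
      by_cases hψ : ψ = 0
      · simp only [hκ, hψ, if_true, AddChar.zero_apply]; push_cast; ring
      · simp only [hκ, hψ, if_false, if_true, AddChar.zero_apply]; ring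
    · rw [S.fourierSum_shiftedColor d ψ hχ, if_neg hχ, add_zero]
  have hsum : ∀ (ψ : AddChar A ℂ), m * fourierSum ((S.colorClass d Y).indicator 1) ψ =
      ∑ y ∈ Y, (∑ χ : AddChar (ZMod m) ℂ, χ (-y) *
        (u * (if ψ = 0 then 1 + χ (-d) else χ (f ψ)) - (1 + χ (-d))) + κ ψ) := by
    intro ψ
    rw [S.card_mul_fourierSum_colorClass]
    refine sum_congr rfl fun y _ => ?_
    simp only [hF]
    have : ∀ χ : AddChar (ZMod m) ℂ, χ (-y) * (u * (if ψ = 0 then 1 + χ (-d) else χ (f ψ)) +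
        (if χ = 0 then κ ψ else 0) - (1 + χ (-d))) =
        χ (-y) * (u * (if ψ = 0 then 1 + χ (-d) else χ (f ψ)) - (1 + χ (-d))) +
        (if χ = 0 then κ ψ else 0) := by
      intro χ
      by_cases hχ : χ = 0
      · simp only [hχ, if_true, AddChar.zero_apply]; ring
      · simp only [hχ, if_false]; ring
    simp only [this, sum_add_distrib]
    simp
  have horth := sum_addChar_zmod_mul (m := m)
  have horth0 : ∀ y : ZMod m, ∑ χ : AddChar (ZMod m) ℂ, χ (-y) = m * if 0 = y then 1 else 0 := by
    intro y
    simpa using horth 0 y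
  refine isLatinSquareConnectionSet_of_fourierSum hu S.card_eq (S.isConnectionSet_colorClass d Y)
    ?_ ?_
  · have h0 := hsum 0
    have h1 : fourierSum ((S.colorClass d Y).indicator 1) 0 = ((S.colorClass d Y).ncard : ℂ) := by
      rw [Set.ncard_eq_toFinset_card']
      simp only [fourierSum, AddChar.zero_apply, one_mul, Set.indicator_apply, Pi.one_apply,
        sum_boole]
      congr 2
      ext
      simp
    have h2 : m * ((S.colorClass d Y).ncard : ℂ) = m * (c * (u - 1)) := by
      rw [← h1, h0, hc', sum_mul, mul_sum]
      refine sum_congr rfl fun y _ => ?_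
      have : ∀ χ : AddChar (ZMod m) ℂ, χ (-y) * (u * (1 + χ (-d)) - (1 + χ (-d))) =
          (u - 1) * χ (-y) + (u - 1) * (χ (-y) * χ (-d)) := fun χ => by ring
      simp only [hκ, if_true, this, sum_add_distrib, ← mul_sum, horth, horth0]
      rw [hur]
      ring
    have h3 := mul_left_cancel₀ hm' h2
    have : ((S.colorClass d Y).ncard : ℂ) = ((c * (u - 1) : ℕ) : ℂ) := by
      rw [h3]; push_cast [Nat.cast_sub hu.le]; ring
    exact_mod_cast this
  · intro ψ hψ
    have h0 := hsum ψ
    have h2 : m * fourierSum ((S.colorClass d Y).indicator 1) ψ =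
        m * (u * (if f ψ ∈ Y then 1 else 0) - c) := by
      have h3 : (if f ψ ∈ Y then (1 : ℂ) else 0) = ∑ y ∈ Y, if f ψ = y then 1 else 0 := by simp
      rw [h0, hc', h3, mul_sum, ← sum_sub_distrib, mul_sum]
      refine sum_congr rfl fun y _ => ?_
      have : ∀ χ : AddChar (ZMod m) ℂ, χ (-y) * (u * χ (f ψ) - (1 + χ (-d))) =
          u * (χ (-y) * χ (f ψ)) - χ (-y) - χ (-y) * χ (-d) := fun χ => by ring
      simp only [hκ, hψ, if_false, this, sum_sub_distrib, ← mul_sum, horth, horth0]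
      rw [hur]
      ring
    have h3 := mul_left_cancel₀ hm' h2
    rw [h3]
    by_cases hf : f ψ ∈ Y
    · left; simp [hf]
    · right; simp [hf]

end PairedColoring

/-! ### Discrete logarithms and additive characters of finite fields -/

section Log

variable {M : Type*} [Field M] [Fintype M]

theorem exists_pow_eq_of_generator {g : Mˣ} (hg : ∀ x, x ∈ Subgroup.zpowers g) {x : M}
    (hx : x ≠ 0) : ∃ k : ℕ, (g : M) ^ k = x := by
  obtain ⟨k, hk⟩ := (mem_powers_iff_mem_zpowers.2 (hg (Units.mk0 x hx)))
  exact ⟨k, by simpa using congrArg Units.val hk⟩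

/-- `c` is the discrete logarithm to the base `g`, reduced modulo `N`; its value at `0` is
irrelevant. -/
structure IsLog (g : Mˣ) {N : ℕ} (c : M → ZMod N) : Prop where
  mem_zpowers : ∀ x, x ∈ Subgroup.zpowers g
  apply_pow : ∀ k : ℕ, c ((g : M) ^ k) = k

theorem exists_isLog {g : Mˣ} (hg : ∀ x, x ∈ Subgroup.zpowers g) {N : ℕ}
    (hN : N ∣ Fintype.card M - 1) : ∃ c : M → ZMod N, IsLog g c := by
  classical
  refine ⟨fun x => if h : ∃ k : ℕ, (g : M) ^ k = x then (h.choose : ZMod N) else 0, hg, fun k => ?_⟩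
  have h : ∃ l : ℕ, (g : M) ^ l = (g : M) ^ k := ⟨k, rfl⟩
  rw [dif_pos h]
  have h1 : g ^ h.choose = g ^ k := Units.ext (by simpa using h.choose_spec)
  rw [pow_eq_pow_iff_modEq, orderOf_eq_card_of_forall_mem_zpowers hg, Nat.card_eq_fintype_card,
    Fintype.card_units] at h1
  exact (ZMod.natCast_eq_natCast_iff _ _ _).2 (h1.of_dvd hN)

namespace IsLog

variable {g : Mˣ} {N : ℕ} {c : M → ZMod N}

theorem exists_pow (hc : IsLog g c) {x : M} (hx : x ≠ 0) : ∃ k : ℕ, (g : M) ^ k = x :=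
  exists_pow_eq_of_generator hc.mem_zpowers hx

theorem map_mul (hc : IsLog g c) {x y : M} (hx : x ≠ 0) (hy : y ≠ 0) :
    c (x * y) = c x + c y := by
  obtain ⟨k, rfl⟩ := hc.exists_pow hx
  obtain ⟨l, rfl⟩ := hc.exists_pow hy
  rw [← pow_add, hc.apply_pow, hc.apply_pow, hc.apply_pow, Nat.cast_add]

theorem pow_eq_one_iff (hc : IsLog g c) (k : ℕ) :
    (g : M) ^ k = 1 ↔ Fintype.card M - 1 ∣ k := by
  classical
  have h : orderOf (g : M) = Fintype.card M - 1 := by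
    rw [orderOf_units, orderOf_eq_card_of_forall_mem_zpowers hc.mem_zpowers,
      Nat.card_eq_fintype_card, Fintype.card_units]
  rw [← h, orderOf_dvd_iff_pow_eq_one]

/-- Logarithms are even functions, because the logarithm of `-1` is half the order of the
multiplicative group. -/
theorem map_neg (hc : IsLog g c) (hN : 2 * N ∣ Fintype.card M - 1) (x : M) : c (-x) = c x := by
  by_cases hx : x = 0
  · simp [hx]
  have hone : c (-1) = 0 := by
    obtain ⟨k, hk⟩ := hc.exists_pow (neg_ne_zero.2 (one_ne_zero (α := M)))
    have h2 : (g : M) ^ (2 * k) = 1 := by rw [mul_comm, pow_mul, hk]; ring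
    rw [hc.pow_eq_one_iff] at h2
    have h3 := Nat.dvd_of_mul_dvd_mul_left two_pos (hN.trans h2)
    rw [← hk, hc.apply_pow]
    exact (ZMod.natCast_eq_zero_iff _ _).2 h3
  rw [← neg_one_mul, hc.map_mul (neg_ne_zero.2 one_ne_zero) hx, hone, zero_add]

end IsLog

open Classical in
/-- The sum of an additive character over a class of a logarithm (a cyclotomic period). -/
noncomputable def classSum {N : ℕ} (c : M → ZMod N) (ψ : AddChar M ℂ) (j : ZMod N) : ℂ :=
  ∑ x with x ≠ 0 ∧ c x = j, ψ x

theorem classSum_mulShift {g : Mˣ} {N : ℕ} {c : M → ZMod N} (hc : IsLog g c) (ψ : AddChar M ℂ)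
    {a : M} (ha : a ≠ 0) (j : ZMod N) :
    classSum c (ψ.mulShift a) j = classSum c ψ (j + c a) := by
  refine sum_bij (fun x _ => a * x) ?_ ?_ ?_ ?_
  · intro x hx
    simp only [mem_filter, mem_univ, true_and] at hx ⊢
    exact ⟨mul_ne_zero ha hx.1, by rw [hc.map_mul ha hx.1, hx.2, add_comm]⟩
  · intro x _ y _ h
    exact mul_left_cancel₀ ha h
  · intro y hy
    simp only [mem_filter, mem_univ, true_and] at hy
    refine ⟨a⁻¹ * y, ?_, by field_simp⟩
    simp only [mem_filter, mem_univ, true_and]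
    have h0 : a⁻¹ * y ≠ 0 := mul_ne_zero (inv_ne_zero ha) hy.1
    have h1 := hc.map_mul ha h0
    rw [mul_inv_cancel_left₀ ha, hy.2, add_comm (c a)] at h1
    exact ⟨h0, (add_right_cancel h1).symm⟩
  · intro x _
    rfl

theorem classSum_zero {g : Mˣ} {N : ℕ} [NeZero N] {c : M → ZMod N} (hc : IsLog g c)
    (j : ZMod N) : classSum c 0 j = classSum c 0 0 := by
  have h := classSum_mulShift hc 0 (pow_ne_zero j.val g.ne_zero) 0
  rw [hc.apply_pow, ZMod.natCast_zmod_val, zero_add] at h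
  rw [← h]
  congr 1

theorem sum_classSum {N : ℕ} [NeZero N] (c : M → ZMod N) (ψ : AddChar M ℂ) :
    ∑ j, classSum c ψ j = ∑ x, ψ x - 1 := by
  classical
  have h : ∑ x with x ≠ 0, ψ x = ∑ j, classSum c ψ j := by
    rw [← sum_fiberwise (s := univ.filter fun x : M => x ≠ 0) (g := c)]
    refine sum_congr rfl fun j _ => ?_
    rw [classSum, filter_filter]
  rw [← h, filter_ne', sum_erase_eq_sub (mem_univ _), AddChar.map_zero_eq_one]

/-- Let `M` have order `v ^ 2`. The classes of the logarithm modulo `v + 1` are the one-dimensional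
subspaces over the subfield of order `v`, without the origin. A nontrivial additive character is
trivial on exactly one of these, the one of logarithm `j₀`. -/
theorem exists_classSum_eq_of_sq {v : ℕ} (hv : 1 < v) (hcard : Fintype.card M = v ^ 2)
    (hadd : ∀ x y : M, (x + y) ^ v = x ^ v + y ^ v) {g : Mˣ} {c : M → ZMod (v + 1)}
    (hc : IsLog g c) {ψ : AddChar M ℂ} (hψ : ψ ≠ 0) :
    ∃ j₀, ∀ j, classSum c ψ j = v * (if j = j₀ then 1 else 0) + -1 := by
  classical
  have hv0 : v ≠ 0 := by omega
  -- the subfield of order `v`, as an additive group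
  let S : AddSubgroup M :=
    { carrier := {x | x ^ v = x}
      zero_mem' := zero_pow hv0
      add_mem' := fun {x y} hx hy => by
        simp only [Set.mem_ofPred_eq] at *
        rw [hadd, hx, hy]
      neg_mem' := fun {x} hx => by
        simp only [Set.mem_ofPred_eq] at *
        have := hadd x (-x)
        rw [add_neg_cancel, zero_pow hv0, hx] at this
        exact (neg_eq_of_add_eq_zero_right this.symm).symm }
  have hS : ∀ x : M, x ≠ 0 → (x ∈ S ↔ c x = 0) := by
    intro x hx
    obtain ⟨k, rfl⟩ := hc.exists_pow hx
    have h1 : ((g : M) ^ k ∈ S) ↔ (g : M) ^ (k * (v - 1)) = 1 := by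
      change ((g : M) ^ k) ^ v = (g : M) ^ k ↔ _
      obtain ⟨w, rfl⟩ : ∃ w, v = w + 1 := ⟨v - 1, by omega⟩
      rw [Nat.add_sub_cancel, pow_succ, ← pow_mul]
      exact mul_eq_right₀ hx
    have h2 : v ^ 2 - 1 = (v + 1) * (v - 1) := by
      have := Nat.sq_sub_sq v 1
      simpa using this
    rw [h1, hc.pow_eq_one_iff, hcard, h2, hc.apply_pow, ZMod.natCast_eq_zero_iff]
    exact Nat.mul_dvd_mul_iff_right (by omega)
  -- every class is a multiple of `S`
  have hclass : ∀ (φ : AddChar M ℂ) (j : ZMod (v + 1)), classSum c φ j =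
      ∑ t : S, φ.compAddMonoidHom
        ((AddMonoidHom.mulLeft ((g : M) ^ j.val)).comp S.subtype) t - 1 := by
    intro φ j
    have h0 : classSum c φ j = classSum c (φ.mulShift ((g : M) ^ j.val)) 0 := by
      rw [classSum_mulShift hc _ (pow_ne_zero _ g.ne_zero), hc.apply_pow, ZMod.natCast_zmod_val,
        zero_add]
    rw [h0, classSum]
    have h1 : ∑ t : S, φ.compAddMonoidHom
        ((AddMonoidHom.mulLeft ((g : M) ^ j.val)).comp S.subtype) t =
        ∑ x with x ∈ S, φ.mulShift ((g : M) ^ j.val) x :=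
      (sum_subtype _ (fun x => by simp) fun x => φ.mulShift ((g : M) ^ j.val) x).symm
    have h2 : (univ.filter fun x : M => x ∈ S) =
        insert 0 (univ.filter fun x : M => x ≠ 0 ∧ c x = 0) := by
      ext x
      by_cases hx : x = 0
      · simp [hx, S.zero_mem]
      · simp [hx, hS x hx]
    rw [h1, h2, sum_insert (by simp), AddChar.map_zero_eq_one, add_sub_cancel_left]
  have hScard : (Fintype.card S : ℂ) = v := by
    have h := sum_classSum c (0 : AddChar M ℂ)
    have h1 : ∀ j : ZMod (v + 1), classSum c 0 j = (Fintype.card S : ℂ) - 1 := by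
      intro j
      rw [hclass]
      simp
    simp only [h1, AddChar.zero_apply, sum_const, card_univ, hcard, ZMod.card, nsmul_eq_mul] at h
    push_cast at h
    have hv1 : (v : ℂ) + 1 ≠ 0 := by exact_mod_cast (Nat.succ_ne_zero v)
    apply mul_left_cancel₀ hv1
    linear_combination h
  let P : ZMod (v + 1) → Prop := fun j => ψ.compAddMonoidHom
    ((AddMonoidHom.mulLeft ((g : M) ^ j.val)).comp S.subtype) = 0
  have hP : ∀ j, classSum c ψ j = v * (if P j then 1 else 0) + -1 := by
    intro j
    rw [hclass, AddChar.sum_eq_ite, hScard]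
    by_cases h : P j
    · rw [if_pos h, if_pos h]; ring
    · rw [if_neg h, if_neg h]; ring
  have hcount : #(univ.filter P) = 1 := by
    have h := sum_classSum c ψ
    rw [AddChar.sum_eq_zero_iff_ne_zero.2 hψ] at h
    simp only [hP, sum_add_distrib, ← mul_sum, sum_boole, sum_const, card_univ, ZMod.card,
      nsmul_eq_mul] at h
    have hv' : (v : ℂ) ≠ 0 := Nat.cast_ne_zero.2 hv0
    have : (v : ℂ) * #(univ.filter P) = v * 1 := by
      push_cast at h
      linear_combination h
    exact_mod_cast mul_left_cancel₀ hv' this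
  obtain ⟨j₀, hj₀⟩ := card_eq_one.1 hcount
  refine ⟨j₀, fun j => ?_⟩
  have : P j ↔ j = j₀ := by
    rw [← mem_singleton, ← hj₀]; simp
  rw [hP]
  simp only [this]

end Log

/-! ### The norm form of a quadratic extension -/

section Norm

theorem sum_eq_add_sum_units {F : Type*} [Field F] [Fintype F] [DecidableEq F] (f : F → ℂ) :
    ∑ x, f x = f 0 + ∑ x : Fˣ, f x := by
  rw [← add_sum_erase univ f (mem_univ 0)]
  congr 1
  refine (sum_bij (fun (x : Fˣ) _ => (x : F)) ?_ ?_ ?_ ?_).symm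
  · intro x _; simp
  · intro x _ y _ h; exact Units.ext h
  · intro y hy
    exact ⟨Units.mk0 y (by simpa using hy), mem_univ _, rfl⟩
  · intro x _; rfl

theorem sum_comp_eq_card_mul_sum {G H : Type*} [Group G] [Group H] [Fintype G] [Fintype H]
    {φ : G →* H} (hφ : Function.Surjective φ) {k : ℕ} (hk : Fintype.card G = k * Fintype.card H)
    (f : H → ℂ) : ∑ x, f (φ x) = k * ∑ y, f y := by
  classical
  have h1 : ∀ F : H → ℂ, ∑ x, F (φ x) = #(univ.filter fun x => φ x = 1) * ∑ y, F y := by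
    intro F
    rw [← sum_fiberwise (s := univ) (g := φ), mul_sum]
    refine sum_congr rfl fun y _ => ?_
    rw [sum_congr rfl (g := fun _ => F y) fun x hx => by rw [(mem_filter.1 hx).2], sum_const,
      nsmul_eq_mul, MonoidHom.card_fiber_eq_of_mem_range φ (hφ y) (hφ 1)]
  have h2 := h1 fun _ => 1
  have hH : (Fintype.card H : ℂ) ≠ 0 := Nat.cast_ne_zero.2 Fintype.card_ne_zero
  simp only [sum_const, card_univ, hk, nsmul_eq_mul, mul_one] at h2
  push_cast at h2
  rw [h1 f, mul_right_cancel₀ hH h2]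

variable {K L : Type*} [Field K] [Field L] [Fintype K] [Fintype L] [Algebra K L] {u : ℕ}

theorem sum_addChar_norm (hK : Fintype.card K = u) (hL : Fintype.card L = u ^ 2)
    {θ : AddChar K ℂ} (hθ : θ ≠ 0) {w : K} (hw : w ≠ 0) :
    ∑ x : L, θ (-(w * Algebra.norm K x)) = -u := by
  classical
  have hu : 1 < u := hK ▸ Fintype.one_lt_card
  have hcard : Fintype.card Lˣ = (u + 1) * Fintype.card Kˣ := by
    rw [Fintype.card_units, Fintype.card_units, hK, hL]
    simpa using Nat.sq_sub_sq u 1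
  have hz : ∑ z : K, θ (-(w * z)) = 0 := by
    have h := AddChar.sum_mulShift (-w) (AddChar.IsPrimitive.of_ne_one hθ)
    rw [if_neg (neg_ne_zero.2 hw)] at h
    rw [← Nat.cast_zero, ← h]
    exact sum_congr rfl fun z _ => by ring_nf
  rw [sum_eq_add_sum_units] at hz
  rw [sum_eq_add_sum_units]
  have h := sum_comp_eq_card_mul_sum (FiniteField.unitsMap_norm_surjective K L) hcard
    fun z : Kˣ => θ (-(w * (z : K)))
  simp only [Units.coe_map] at h
  simp only [Algebra.norm_zero, mul_zero, neg_zero, AddChar.map_zero_eq_one] at hz ⊢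
  rw [h]
  push_cast
  linear_combination ((u : ℂ) + 1) * hz

/-- Completing the square in the norm form of a quadratic extension. -/
theorem sum_addChar_trace_sub_norm (hK : Fintype.card K = u) (hL : Fintype.card L = u ^ 2)
    {θ : AddChar K ℂ} (hθ : θ ≠ 0) {w : K} (hw : w ≠ 0) (a : L) :
    ∑ x : L, θ (Algebra.trace K L (a * x) - w * Algebra.norm K x) =
      -u * θ (Algebra.norm K a / w) := by
  have hu : 1 < u := hK ▸ Fintype.one_lt_card
  have hrank : Module.finrank K L = 2 := by
    have h := Module.card_eq_pow_finrank (K := K) (V := L)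
    rw [hK, hL] at h
    exact (Nat.pow_right_injective hu h).symm
  let σ := FiniteField.frobeniusAlgEquivOfAlgebraic K L
  have hσ : ∀ x : L, σ x = x ^ u := fun x => by simp [σ, hK]
  have htr : ∀ x : L, algebraMap K L (Algebra.trace K L x) = x + σ x := fun x => by
    rw [FiniteField.algebraMap_trace_eq_sum_pow, hrank, hσ]
    simp [sum_range_succ, hK]
  have hnorm : ∀ x : L, algebraMap K L (Algebra.norm K x) = x * σ x := fun x => by
    rw [FiniteField.algebraMap_norm_eq_prod_pow, hrank, hσ]
    simp [prod_range_succ, hK]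
  have hσσ : ∀ x : L, σ (σ x) = x := fun x => by
    rw [hσ, hσ, ← pow_mul, ← sq, ← hL, FiniteField.pow_card]
  have hw' : algebraMap K L w ≠ 0 := by simpa using hw
  set b : L := σ a / algebraMap K L w with hb
  have hid : ∀ x : L, Algebra.trace K L (a * x) - w * Algebra.norm K x =
      Algebra.norm K a / w + -(w * Algebra.norm K (x - b)) := by
    intro x
    apply (algebraMap K L).injective
    simp only [_root_.map_sub, _root_.map_add, _root_.map_neg, _root_.map_mul, map_div₀, htr,
      hnorm, hb, hσσ, AlgEquiv.commutes]
    field_simp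
    ring
  simp only [hid, AddChar.map_add_eq_mul, ← mul_sum]
  rw [Fintype.sum_equiv (Equiv.subRight b) (fun x => θ (-(w * Algebra.norm K (x - b))))
    (fun x => θ (-(w * Algebra.norm K x))) fun x => rfl, sum_addChar_norm hK hL hθ hw]
  ring

end Norm

/-! ### Cyclotomic classes of negative Latin square type -/

section Cyclotomy

variable {K L : Type*} [Field K] [Field L] [Fintype K] [Fintype L] [Algebra K L] {q u : ℕ}

/-- Every additive character of a quadratic extension is `x ↦ θ (trace (a * x))`. -/
theorem exists_eq_trace_mul {θ : AddChar K ℂ} (hθ : θ ≠ 0) {ψ : AddChar L ℂ} (hψ : ψ ≠ 0) :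
    ∃ a : L, a ≠ 0 ∧ ∀ x, ψ x = θ (Algebra.trace K L (a * x)) := by
  classical
  let ψ₁ : AddChar L ℂ := θ.compAddMonoidHom (Algebra.trace K L).toAddMonoidHom
  have hψ₁ : ψ₁ ≠ 1 := by
    obtain ⟨z, hz⟩ := AddChar.ne_zero_iff.1 hθ
    obtain ⟨x, rfl⟩ := Algebra.trace_surjective K L z
    exact AddChar.ne_one_iff.2 ⟨x, hz⟩
  have hbij : Function.Bijective ψ₁.mulShift := by
    rw [Fintype.bijective_iff_injective_and_card]
    exact ⟨AddChar.to_mulShift_inj_of_isPrimitive (AddChar.IsPrimitive.of_ne_one hψ₁),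
      AddChar.card_eq.symm⟩
  obtain ⟨a, rfl⟩ := hbij.2 ψ
  refine ⟨a, ?_, fun x => rfl⟩
  rintro rfl
  exact hψ (AddChar.mulShift_zero ψ₁)

open Classical in
/-- Fourier inversion for the indicator function of a class of a logarithm. -/
theorem sum_classSum_mulShift {N : ℕ} (c : K → ZMod N) {θ : AddChar K ℂ} (hθ : θ ≠ 0)
    (j : ZMod N) (z : K) :
    ∑ w, classSum c (θ.mulShift w) j * θ (-(w * z)) =
      Fintype.card K * if z ≠ 0 ∧ c z = j then 1 else 0 := by
  simp only [classSum, sum_mul]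
  rw [sum_comm]
  have h : ∀ t : K, ∑ w, θ.mulShift w t * θ (-(w * z)) =
      if t = z then (Fintype.card K : ℂ) else 0 := by
    intro t
    have h := AddChar.sum_mulShift (t - z) (AddChar.IsPrimitive.of_ne_one hθ)
    simp only [sub_eq_zero] at h
    push_cast at h
    rw [← h]
    refine sum_congr rfl fun w _ => ?_
    rw [AddChar.mulShift_apply, ← AddChar.map_add_eq_mul]
    ring_nf
  simp only [h, sum_ite_eq', mem_filter, mem_univ, true_and, mul_ite, mul_one, mul_zero]

/-- Let `K` have order `u = q ^ 2` and let `L` be its quadratic extension. The preimages under the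
norm of the classes of the logarithm modulo `q + 1` on `K` (elliptic quadrics over the field of
order `q`) have periods taking only two values, and `- u` appears for exactly one class. -/
theorem exists_classSum_norm_eq (hq : 1 < q) (hu : u = q ^ 2) (hK : Fintype.card K = u)
    (hL : Fintype.card L = u ^ 2) (hadd : ∀ x y : K, (x + y) ^ q = x ^ q + y ^ q)
    {g : Kˣ} {c : K → ZMod (q + 1)} (hc : IsLog g c) {ψ : AddChar L ℂ} (hψ : ψ ≠ 0) :
    ∃ j₀, ∀ j, classSum (fun x : L => c (Algebra.norm K x)) ψ j =
      -u * (if j = j₀ then 1 else 0) + (q - 1) := by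
  classical
  obtain ⟨θ, hθ⟩ : ∃ θ : AddChar K ℂ, θ ≠ 0 := by
    obtain ⟨θ, h⟩ := AddChar.exists_apply_ne_zero.2 (one_ne_zero (α := K))
    exact ⟨θ, AddChar.ne_zero_iff.2 ⟨1, h⟩⟩
  obtain ⟨a, ha, hψa⟩ := exists_eq_trace_mul (K := K) hθ hψ
  obtain ⟨j₁, hj₁⟩ := exists_classSum_eq_of_sq hq (hK.trans hu) hadd hc hθ
  have hu0 : (u : ℂ) ≠ 0 := by
    rw [← hK]; exact Nat.cast_ne_zero.2 Fintype.card_ne_zero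
  have hn : Algebra.norm K a ≠ 0 := Algebra.norm_ne_zero_iff.2 ha
  -- expand the indicator of the class by Fourier inversion and evaluate the inner sums
  have hexp : ∀ j, (u : ℂ) * classSum (fun x : L => c (Algebra.norm K x)) ψ j =
      -u * ∑ w with w ≠ 0, classSum c (θ.mulShift w) j * θ (Algebra.norm K a / w) := by
    intro j
    have h1 : (u : ℂ) * classSum (fun x : L => c (Algebra.norm K x)) ψ j = ∑ x : L, ψ x *
        ∑ w, classSum c (θ.mulShift w) j * θ (-(w * Algebra.norm K x)) := by
      rw [classSum, sum_filter, mul_sum]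
      refine sum_congr rfl fun x _ => ?_
      rw [sum_classSum_mulShift c hθ, hK]
      simp only [Algebra.norm_ne_zero_iff]
      split_ifs <;> ring
    have h2 : ∀ w, ∑ x : L, ψ x * (classSum c (θ.mulShift w) j * θ (-(w * Algebra.norm K x))) =
        if w ≠ 0 then -u * (classSum c (θ.mulShift w) j * θ (Algebra.norm K a / w)) else 0 := by
      intro w
      have h3 : ∑ x : L, ψ x * (classSum c (θ.mulShift w) j * θ (-(w * Algebra.norm K x))) =
          classSum c (θ.mulShift w) j *
            ∑ x : L, θ (Algebra.trace K L (a * x) - w * Algebra.norm K x) := by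
        rw [mul_sum]
        refine sum_congr rfl fun x _ => ?_
        rw [sub_eq_add_neg, AddChar.map_add_eq_mul, hψa]
        ring
      by_cases hw : w = 0
      · have h4 := AddChar.sum_eq_zero_iff_ne_zero.2 hψ
        simp only [hψa] at h4
        rw [h3, if_neg (not_not.2 hw), hw]
        simp [h4]
      · rw [h3, if_pos hw, sum_addChar_trace_sub_norm hK hL hθ hw]
        ring
    rw [h1]
    simp only [mul_sum]
    rw [sum_comm]
    simp only [h2, ← sum_filter]
  -- substitute `w ↦ norm a / w`
  have hsubst : ∀ F : K → ℂ, ∑ w with w ≠ 0, F w = ∑ v with v ≠ 0, F (Algebra.norm K a / v) := by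
    intro F
    refine sum_bij (fun w _ => Algebra.norm K a / w) ?_ ?_ ?_ ?_
    · intro w hw
      simpa [hn] using hw
    · intro w hw v hv h
      have hw : w ≠ 0 := by simpa using hw
      have hv : v ≠ 0 := by simpa using hv
      field_simp at h
      exact h.symm
    · intro v hv
      have hv : v ≠ 0 := by simpa using hv
      exact ⟨Algebra.norm K a / v, by simp [hn, hv], by field_simp⟩
    · intro w hw
      have hw : w ≠ 0 := by simpa using hw
      congr 1
      field_simp
  have hlog : ∀ v : K, v ≠ 0 → c (Algebra.norm K a / v) = c (Algebra.norm K a) - c v := by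
    intro v hv
    have h := hc.map_mul (div_ne_zero hn hv) hv
    rw [div_mul_cancel₀ _ hv] at h
    rw [h, add_sub_cancel_right]
  refine ⟨j₁ + j₁ - c (Algebra.norm K a), fun j => ?_⟩
  apply mul_left_cancel₀ hu0
  rw [hexp, hsubst]
  have hterm : ∀ v ∈ univ.filter fun v : K => v ≠ 0,
      classSum c (θ.mulShift (Algebra.norm K a / v)) j *
        θ (Algebra.norm K a / (Algebra.norm K a / v)) =
      q * (if v ≠ 0 ∧ c v = j + c (Algebra.norm K a) - j₁ then θ v else 0) - θ v := by
    intro v hv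
    have hv : v ≠ 0 := by simpa using hv
    have hiff : j + c (Algebra.norm K a / v) = j₁ ↔
        v ≠ 0 ∧ c v = j + c (Algebra.norm K a) - j₁ := by
      rw [hlog v hv]
      constructor
      · intro h
        exact ⟨hv, by rw [← h]; ring⟩
      · rintro ⟨-, h⟩
        rw [h]; ring
    rw [classSum_mulShift hc _ (div_ne_zero hn hv), hj₁, div_div_cancel₀ hn]
    simp only [hiff]
    split_ifs <;> ring
  have hsum : ∑ v with v ≠ 0, θ v = -1 := by
    rw [filter_ne', sum_erase_eq_sub (mem_univ _), AddChar.map_zero_eq_one,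
      AddChar.sum_eq_zero_iff_ne_zero.2 hθ, zero_sub]
  have hclass : ∑ v with v ≠ 0, (if v ≠ 0 ∧ c v = j + c (Algebra.norm K a) - j₁ then θ v else 0) =
      classSum c θ (j + c (Algebra.norm K a) - j₁) := by
    rw [classSum, ← sum_filter, filter_filter]
    congr 1
    ext v
    simp only [mem_filter, mem_univ, true_and]
    tauto
  rw [sum_congr rfl hterm, sum_sub_distrib, ← mul_sum, hclass, hsum, hj₁]
  have hiff : j + c (Algebra.norm K a) - j₁ = j₁ ↔ j = j₁ + j₁ - c (Algebra.norm K a) := by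
    rw [sub_eq_iff_eq_add, ← eq_sub_iff_add_eq]
  simp only [hiff]
  rw [hu]
  push_cast
  ring

end Cyclotomy

/-! ### Paired colourings of finite fields -/

section Halves

variable {m : ℕ}

/-- The parity of a residue class; it is meaningful for even moduli. -/
def residueParity {N : ℕ} (j : ZMod N) : Bool := decide (j.val % 2 = 0)

/-- The colour of a residue class: half of its least representative, rounded down. -/
def residueHalf (m : ℕ) {N : ℕ} (j : ZMod N) : ZMod m := ((j.val / 2 : ℕ) : ZMod m)

theorem residueParity_natCast {n : ℕ} (k : ℕ) :
    residueParity (k : ZMod (2 * n)) = decide (k % 2 = 0) := by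
  rw [residueParity, ZMod.val_natCast, Nat.mod_mod_of_dvd _ (Dvd.intro n rfl)]

/-- Among the residue classes of a given parity modulo `2 * n`, each of `0, …, n - 1` occurs
exactly once as a half. -/
theorem sum_residueHalf {n : ℕ} [NeZero (2 * n)] (χ : AddChar (ZMod m) ℂ) (b : Bool) :
    ∑ j : ZMod (2 * n), (if residueParity j = b then χ (residueHalf m j) else 0) =
      ∑ k ∈ range n, χ (k : ZMod m) := by
  let F : ℕ → ℂ := fun i => if decide (i % 2 = 0) = b then χ ((i / 2 : ℕ) : ZMod m) else 0
  have h1 : ∑ j : ZMod (2 * n), F j.val = ∑ i ∈ range (2 * n), F i := by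
    refine sum_bij (fun j _ => j.val) ?_ ?_ ?_ ?_
    · intro j _; exact mem_range.2 (ZMod.val_lt j)
    · intro i _ j _ h; exact ZMod.val_injective _ h
    · intro i hi; exact ⟨(i : ZMod (2 * n)), mem_univ _, ZMod.val_cast_of_lt (mem_range.1 hi)⟩
    · intro j _; rfl
  have h2 : ∀ k : ℕ, ∑ i ∈ range (2 * k), F i = ∑ i ∈ range k, χ (i : ZMod m) := by
    intro k
    induction k with
    | zero => simp
    | succ k ih =>
      rw [show 2 * (k + 1) = 2 * k + 1 + 1 by ring, sum_range_succ, sum_range_succ, ih,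
        sum_range_succ, add_assoc]
      congr 1
      have e1 : (2 * k) % 2 = 0 := by omega
      have e2 : (2 * k + 1) % 2 ≠ 0 := by omega
      have e3 : 2 * k / 2 = k := by omega
      have e4 : (2 * k + 1) / 2 = k := by omega
      simp only [F, e1, e2, e3, e4]
      cases b <;> simp
  exact h1.trans (h2 n)

theorem sum_range_mul_addChar [NeZero m] {χ : AddChar (ZMod m) ℂ} (hχ : χ ≠ 0) (t : ℕ) :
    ∑ k ∈ range (m * t), χ (k : ZMod m) = 0 := by
  have h0 : ∑ k ∈ range m, χ (k : ZMod m) = 0 := by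
    rw [← AddChar.sum_eq_zero_iff_ne_zero.2 hχ]
    symm
    refine sum_bij (fun j _ => j.val) ?_ ?_ ?_ ?_
    · intro j _; exact mem_range.2 (ZMod.val_lt j)
    · intro i _ j _ h; exact ZMod.val_injective _ h
    · intro i hi; exact ⟨(i : ZMod m), mem_univ _, ZMod.val_cast_of_lt (mem_range.1 hi)⟩
    · intro j _; simp
  induction t with
  | zero => simp
  | succ t ih =>
    rw [Nat.mul_succ, sum_range_add, ih, zero_add]
    simpa using h0

/-- The Fourier transform of a colouring by halves of logarithms, when the periods take the value
`a + b` for the class `j₀` and `b` for all other classes. -/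
theorem fourierSum_residueHalf {M : Type*} [Field M] [Fintype M] {n : ℕ} [NeZero (2 * n)]
    (c : M → ZMod (2 * n)) (χ : AddChar (ZMod m) ℂ) (z : ℂ) (s : Bool) (ψ : AddChar M ℂ) {a b : ℂ}
    {j₀ : ZMod (2 * n)} (h : ∀ j, classSum c ψ j = a * (if j = j₀ then 1 else 0) + b) :
    fourierSum (colorFun χ z s (fun x => residueParity (c x)) fun x => residueHalf m (c x)) ψ =
      z + a * (if residueParity j₀ = s then χ (residueHalf m j₀) else 0) +
        b * ∑ k ∈ range n, χ (k : ZMod m) := by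
  classical
  let F : ZMod (2 * n) → ℂ := fun j => if residueParity j = s then χ (residueHalf m j) else 0
  have h1 : fourierSum (colorFun χ z s (fun x => residueParity (c x))
      fun x => residueHalf m (c x)) ψ = z + ∑ j, F j * classSum c ψ j := by
    rw [fourierSum, ← add_sum_erase univ _ (mem_univ 0), ← filter_ne']
    congr 1
    · simp [colorFun]
    · rw [← sum_fiberwise (s := univ.filter fun x : M => x ≠ 0) (g := c)]
      refine sum_congr rfl fun j _ => ?_
      rw [classSum, filter_filter, mul_sum]
      refine sum_congr rfl fun x hx => ?_
      simp only [mem_filter, mem_univ, true_and] at hx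
      simp only [colorFun, hx.1, if_false, hx.2, F]
      ring
  have h2 : ∑ j, F j * classSum c ψ j = a * F j₀ + b * ∑ j, F j := by
    simp only [h, mul_add, sum_add_distrib, mul_sum]
    congr 1
    · simp [mul_comm]
    · exact sum_congr rfl fun _ _ => by ring
  rw [h1, h2, sum_residueHalf, add_assoc]

end Halves

section Base

theorem mul_classSum_zero {M : Type*} [Field M] [Fintype M] {g : Mˣ} {N : ℕ} [NeZero N]
    {c : M → ZMod N} (hc : IsLog g c) (j : ZMod N) :
    (N : ℂ) * classSum c 0 j = Fintype.card M - 1 := by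
  have h := sum_classSum c (0 : AddChar M ℂ)
  simp only [classSum_zero hc] at h
  rw [classSum_zero hc]
  simpa using h

/-- The paired colouring of a field `L` of order `q ^ 4`, where `2 * m ∣ q + 1`. The type of a
point is its quadratic character. The squares are a union of lines over the subfield `K` of order
`q ^ 2`, which are coloured by `α`, and also a union of elliptic quadrics over the subfield of
order `q`, which are coloured by `β`. -/
theorem nonempty_pairedColoring_field {K L : Type*} [Field K] [Field L] [Fintype K] [Fintype L]
    [Algebra K L] {m q : ℕ} [NeZero m] (hq : 1 < q) (hmq : 2 * m ∣ q + 1)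
    (hK : Fintype.card K = q ^ 2) (hL : Fintype.card L = (q ^ 2) ^ 2)
    (haddK : ∀ x y : K, (x + y) ^ q = x ^ q + y ^ q)
    (haddL : ∀ x y : L, (x + y) ^ (q ^ 2) = x ^ (q ^ 2) + y ^ (q ^ 2)) :
    Nonempty (PairedColoring m (q ^ 2) L) := by
  classical
  obtain ⟨t, ht⟩ := hmq
  have ht0 : 0 < t := Nat.pos_of_ne_zero (by rintro rfl; omega)
  -- half the number of quadrics, and half the number of lines
  obtain ⟨n₂, hn₂, hn₂m⟩ : ∃ n₂, q + 1 = 2 * n₂ ∧ n₂ = m * t := ⟨m * t, by rw [ht]; ring, rfl⟩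
  obtain ⟨n₁, hn₁, hn₁m⟩ : ∃ n₁, q ^ 2 + 1 = 2 * n₁ ∧ n₁ = m * (t * (q - 1)) + 1 := by
    refine ⟨m * (t * (q - 1)) + 1, ?_, rfl⟩
    obtain ⟨w, rfl⟩ : ∃ w, q = w + 1 := ⟨q - 1, by omega⟩
    simp only [Nat.add_sub_cancel]
    have : m * t * 2 = w + 2 := by rw [← hn₂m]; omega
    nlinarith
  have hn₁0 : NeZero (2 * n₁) := ⟨by omega⟩
  have hn₂0 : NeZero (2 * n₂) := ⟨by omega⟩
  have hu1 : 1 < q ^ 2 := Nat.one_lt_pow two_ne_zero hq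
  have hqsub : q ^ 2 - 1 = (q + 1) * (q - 1) := by simpa using Nat.sq_sub_sq q 1
  have husub : (q ^ 2) ^ 2 - 1 = (q ^ 2 + 1) * (q ^ 2 - 1) := by
    simpa using Nat.sq_sub_sq (q ^ 2) 1
  have hqm1 : 2 ∣ q - 1 := by omega
  have hneg₁ : 2 * (2 * n₁) ∣ Fintype.card L - 1 := by
    rw [hL, husub, hn₁, mul_comm]
    exact mul_dvd_mul_left _ (by rw [hqsub]; exact hqm1.mul_left _)
  have hneg₂ : 2 * (2 * n₂) ∣ Fintype.card L - 1 := by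
    rw [hL, husub, hqsub, hn₁, hn₂]
    exact mul_dvd_mul (dvd_mul_right _ _) (dvd_mul_right _ _)
  obtain ⟨g, hg⟩ := IsCyclic.exists_generator (α := Lˣ)
  -- the norm of a generator is a generator
  have hgK : ∀ x, x ∈ Subgroup.zpowers (Units.map (Algebra.norm K (S := L)) g) := by
    intro x
    obtain ⟨y, rfl⟩ := FiniteField.unitsMap_norm_surjective K L x
    obtain ⟨k, rfl⟩ := hg y
    exact ⟨k, (map_zpow _ _ _).symm⟩
  obtain ⟨c₁, hc₁, hline⟩ : ∃ c₁ : L → ZMod (2 * n₁), IsLog g c₁ ∧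
      ∀ ψ : AddChar L ℂ, ∃ j₀, ψ ≠ 0 → ∀ j, classSum c₁ ψ j =
        ((q ^ 2 : ℕ) : ℂ) * (if j = j₀ then 1 else 0) + -1 := by
    rw [← hn₁]
    obtain ⟨c, hc⟩ := exists_isLog hg (N := q ^ 2 + 1) (by rw [hL, husub]; exact dvd_mul_right _ _)
    refine ⟨c, hc, fun ψ => ?_⟩
    by_cases hψ : ψ = 0
    · exact ⟨0, fun h => absurd hψ h⟩
    · obtain ⟨j₀, h⟩ := exists_classSum_eq_of_sq hu1 hL haddL hc hψ
      exact ⟨j₀, fun _ => h⟩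
  obtain ⟨c₂, hc₂, hquadric⟩ : ∃ c₂ : L → ZMod (2 * n₂), IsLog g c₂ ∧
      ∀ ψ : AddChar L ℂ, ∃ j₀, ψ ≠ 0 → ∀ j, classSum c₂ ψ j =
        -((q ^ 2 : ℕ) : ℂ) * (if j = j₀ then 1 else 0) + (q - 1) := by
    rw [← hn₂]
    obtain ⟨c, hc⟩ := exists_isLog hgK (N := q + 1) (by rw [hK, hqsub]; exact dvd_mul_right _ _)
    refine ⟨fun x => c (Algebra.norm K x), ⟨hg, fun k => ?_⟩, fun ψ => ?_⟩
    · have h := hc.apply_pow k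
      rwa [Units.coe_map, ← map_pow] at h
    by_cases hψ : ψ = 0
    · exact ⟨0, fun h => absurd hψ h⟩
    · obtain ⟨j₀, h⟩ := exists_classSum_norm_eq hq rfl hK hL haddK hc hψ
      exact ⟨j₀, fun _ => h⟩
  choose j₁ hj₁ using hline
  choose j₂ hj₂ using hquadric
  have hpar : ∀ x, x ≠ 0 → residueParity (c₁ x) = residueParity (c₂ x) := by
    intro x hx
    obtain ⟨k, rfl⟩ := hc₁.exists_pow hx
    rw [hc₁.apply_pow, hc₂.apply_pow, residueParity_natCast, residueParity_natCast]
  have hcolor : ∀ (χ : AddChar (ZMod m) ℂ) (z : ℂ) (b : Bool),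
      colorFun χ z b (fun x => residueParity (c₁ x)) (fun x => residueHalf m (c₂ x)) =
      colorFun χ z b (fun x => residueParity (c₂ x)) (fun x => residueHalf m (c₂ x)) := by
    intro χ z b
    funext x
    by_cases hx : x = 0
    · simp [colorFun, hx]
    · simp only [colorFun, hpar x hx]
  have hn₁c : (q : ℂ) ^ 2 + 1 = 2 * n₁ := by exact_mod_cast hn₁
  have hn₂c : (q : ℂ) + 1 = 2 * n₂ := by exact_mod_cast hn₂
  have hq0 : ((q ^ 2 : ℕ) : ℂ) ≠ 0 := Nat.cast_ne_zero.2 (by omega)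
  -- the squares are unions of both kinds of classes; comparing the two values of their transform
  -- shows that the two dual types are opposite
  have hdual : ∀ ψ, ψ ≠ 0 → residueParity (j₂ ψ) = !residueParity (j₁ ψ) := by
    intro ψ hψ
    have h1 := fourierSum_residueHalf c₁ (0 : AddChar (ZMod m) ℂ) 0 true ψ (hj₁ ψ hψ)
    have h2 := fourierSum_residueHalf c₂ (0 : AddChar (ZMod m) ℂ) 0 true ψ (hj₂ ψ hψ)
    have h3 : colorFun (0 : AddChar (ZMod m) ℂ) 0 true (fun x => residueParity (c₁ x))
        (fun x => residueHalf m (c₁ x)) = colorFun (0 : AddChar (ZMod m) ℂ) 0 true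
        (fun x => residueParity (c₂ x)) (fun x => residueHalf m (c₂ x)) := by
      rw [← hcolor]
      funext x
      simp [colorFun]
    rw [h3, h2] at h1
    simp only [AddChar.zero_apply, sum_const, card_range, nsmul_eq_mul, mul_one] at h1
    have h4 : ((q ^ 2 : ℕ) : ℂ) * ((if residueParity (j₁ ψ) = true then 1 else 0) +
        (if residueParity (j₂ ψ) = true then 1 else 0)) = ((q ^ 2 : ℕ) : ℂ) * 1 := by
      push_cast at h1 ⊢
      linear_combination -h1 - hn₁c / 2 - hn₂c * (q - 1) / 2
    have h5 := mul_left_cancel₀ hq0 h4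
    cases h : residueParity (j₁ ψ) <;> cases h' : residueParity (j₂ ψ) <;>
      simp [h, h'] at h5 ⊢
  have hsum₁ : ∀ χ : AddChar (ZMod m) ℂ, χ ≠ 0 → ∑ k ∈ range n₁, χ (k : ZMod m) = 1 := by
    intro χ hχ
    rw [hn₁m, sum_range_succ, sum_range_mul_addChar hχ]
    simp
  have hsum₂ : ∀ χ : AddChar (ZMod m) ℂ, χ ≠ 0 → ∑ k ∈ range n₂, χ (k : ZMod m) = 0 := by
    intro χ hχ
    rw [hn₂m, sum_range_mul_addChar hχ]
  exact ⟨{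
    τ := fun x => residueParity (c₁ x)
    α := fun x => residueHalf m (c₁ x)
    β := fun x => residueHalf m (c₂ x)
    τdual := fun ψ => residueParity (j₁ ψ)
    αdual := fun ψ => residueHalf m (j₁ ψ)
    βdual := fun ψ => residueHalf m (j₂ ψ)
    card_eq := hL
    τ_neg := fun x => by rw [hc₁.map_neg hneg₁]
    α_neg := fun x => by rw [hc₁.map_neg hneg₁]
    β_neg := fun x => by rw [hc₂.map_neg hneg₂]
    fourierSum_α := fun χ hχ b ψ => by
      by_cases hψ : ψ = 0
      · subst hψ
        have h : ∀ j, classSum c₁ 0 j =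
            0 * (if j = 0 then 1 else 0) + (((q ^ 2 : ℕ) : ℂ) - 1) := by
          intro j
          have h := mul_classSum_zero hc₁ j
          apply mul_left_cancel₀ (Nat.cast_ne_zero.2 hn₁0.out : ((2 * n₁ : ℕ) : ℂ) ≠ 0)
          rw [h, hL]
          push_cast
          linear_combination ((q : ℂ) ^ 2 - 1) * hn₁c
        rw [fourierSum_residueHalf c₁ χ 1 b 0 h, hsum₁ χ hχ, colorFun, if_pos rfl]
        ring
      · rw [fourierSum_residueHalf c₁ χ 1 b ψ (hj₁ ψ hψ), hsum₁ χ hχ, colorFun, if_neg hψ]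
        ring
    fourierSum_β := fun χ hχ b ψ => by
      rw [hcolor]
      by_cases hψ : ψ = 0
      · subst hψ
        have h : ∀ j, classSum c₂ 0 j = 0 * (if j = 0 then 1 else 0) + classSum c₂ 0 0 := by
          intro j
          rw [classSum_zero hc₂, zero_mul, zero_add]
        rw [fourierSum_residueHalf c₂ χ 0 b 0 h, hsum₂ χ hχ, colorFun, if_pos rfl]
        ring
      · rw [fourierSum_residueHalf c₂ χ 0 b ψ (hj₂ ψ hψ), hsum₂ χ hχ, colorFun, if_neg hψ,
          hdual ψ hψ]
        cases residueParity (j₁ ψ) <;> cases b <;> simp }⟩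

/-- Elementary abelian groups of order `q ^ 4` are additive groups of fields, hence carry paired
colourings. -/
theorem nonempty_pairedColoring_of_isElementaryAbelian {A : Type*} [AddCommGroup A] [Fintype A]
    (hA : IsElementaryAbelian A) {m q : ℕ} [NeZero m] (hq : IsPrimePow q) (hmq : 2 * m ∣ q + 1)
    (hcard : Fintype.card A = q ^ 4) : Nonempty (PairedColoring m (q ^ 2) A) := by
  classical
  obtain ⟨p, hp, hpA⟩ := hA
  obtain ⟨r, k, hr, hk, rfl⟩ := hq
  have hr := hr.nat_prime
  have : Fact p.Prime := ⟨hp⟩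
  let : Module (ZMod p) A := AddCommGroup.zmodModule hpA
  have hfin := Module.card_eq_pow_finrank (K := ZMod p) (V := A)
  rw [ZMod.card, hcard] at hfin
  obtain rfl : r = p := by
    have h1 : r ∣ p ^ Module.finrank (ZMod p) A := by
      rw [← hfin]
      exact dvd_pow (dvd_pow_self r hk.ne') (by norm_num)
    exact (Nat.prime_dvd_prime_iff_eq hr hp).1 (hr.dvd_of_dvd_pow h1)
  let K := GaloisField r (2 * k)
  let L := FiniteField.Extension K r 2
  let : Fintype K := Fintype.ofFinite K
  let : Fintype L := Fintype.ofFinite L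
  have hK : Fintype.card K = (r ^ k) ^ 2 := by
    rw [Fintype.card_eq_nat_card, GaloisField.card r (2 * k) (by omega)]
    ring
  have hL : Fintype.card L = ((r ^ k) ^ 2) ^ 2 := by
    rw [Fintype.card_eq_nat_card, FiniteField.natCard_extension, ← Fintype.card_eq_nat_card, hK]
  have hfinL := Module.card_eq_pow_finrank (K := ZMod r) (V := L)
  rw [ZMod.card, hL] at hfinL
  have hrank : Module.finrank (ZMod r) A = Module.finrank (ZMod r) L := by
    apply Nat.pow_right_injective hr.two_le
    simp only
    rw [← hfin, ← hfinL]
    ring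
  have hcharK : CharP K r := inferInstance
  have hcharL : CharP L r := charP_of_injective_algebraMap (algebraMap (ZMod r) L).injective r
  obtain ⟨S⟩ := nonempty_pairedColoring_field (K := K) (L := L) (m := m) (q := r ^ k)
    (Nat.one_lt_pow hk.ne' hr.one_lt) hmq hK hL (fun x y => add_pow_char_pow x y r k)
    (fun x y => by rw [← pow_mul]; exact add_pow_char_pow x y r (k * 2))
  exact ⟨S.congr (LinearEquiv.ofFinrankEq A L hrank).toAddEquiv⟩

end Base

/-! ### Strongly regular decompositions -/

theorem exists_finset_card_eq_inter {ι : Type*} [Fintype ι] [DecidableEq ι] (s : Finset ι)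
    {i j : ℕ} (hj : j ≤ #s) (hi : i + #s ≤ Fintype.card ι) :
    ∃ Y : Finset ι, #Y = i + j ∧ #(s ∩ Y) = j := by
  obtain ⟨Y₁, h1, rfl⟩ := exists_subset_card_eq hj
  obtain ⟨Y₂, h2, rfl⟩ := exists_subset_card_eq (s := sᶜ) (n := i) (by
    rw [card_compl]; omega)
  have hdis : Disjoint Y₂ s := by
    rw [disjoint_comm, ← le_compl_iff_disjoint_left]
    exact h2
  refine ⟨Y₂ ∪ Y₁, card_union_of_disjoint (hdis.mono_right h1), ?_⟩
  rw [inter_union_distrib_left, disjoint_iff_inter_eq_empty.1 hdis.symm, empty_union,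
    inter_eq_right.2 h1]

theorem theorem1p4 (m s : ℕ) (hm : 0 < m) (hs : 0 < s)
    (q : Fin s → ℕ) (hq : ∀ i, IsPrimePow (q i)) (hmq : ∀ i, 2 * m ∣ q i + 1)
    (G : Fin s → Type*) [∀ i, AddCommGroup (G i)] [∀ i, Fintype (G i)]
    (hG : ∀ i, IsElementaryAbelian (G i)) (hcard : ∀ i, Fintype.card (G i) = q i ^ 4)
    (u : ℕ) (hu : u = ∏ i, q i ^ 2) :
    m ∣ u - 1 ∧
    ∃ T : ZMod m → ZMod m → Set (∀ i, G i),
      -- every set `T y₁ y₂` is itself of Latin square type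
      (∀ y₁ y₂ : ZMod m, IsLatinSquareConnectionSet (T y₁ y₂) u
        ((u - 1) / m + (if y₁ = 0 then 1 else 0) + (if y₂ = 0 then 1 else 0))) ∧
      -- for each `y₂`, the sets `T y₁ (y₁ + y₂)` decompose the complete graph
      (∀ y₂ : ZMod m,
        Pairwise (fun y y' : ZMod m => Disjoint (T y (y + y₂)) (T y' (y' + y₂))) ∧
        (⋃ y : ZMod m, T y (y + y₂)) = {0}ᶜ) ∧
      -- first form of `c`, for `0 ≤ i ≤ m - 2` and `j ∈ {0, 1, 2}`
      (∀ i j : ℕ, i + 2 ≤ m → j ≤ 2 → ∃ (y₂ : ZMod m) (Y : Set (ZMod m)),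
        IsLatinSquareConnectionSet (⋃ y ∈ Y, T y (y + y₂)) u ((i + j) * ((u - 1) / m) + j)) ∧
      -- second form of `c`, for `0 ≤ i ≤ m - 1` and `j ∈ {0, 1}`
      (∀ i j : ℕ, i + 1 ≤ m → j ≤ 1 → ∃ (y₂ : ZMod m) (Y : Set (ZMod m)),
        IsLatinSquareConnectionSet (⋃ y ∈ Y, T y (y + y₂)) u
          ((j + i) * ((u - 1) / m) + 2 * j)) := by
  classical
  have : NeZero m := ⟨hm.ne'⟩
  obtain ⟨S⟩ : Nonempty (PairedColoring m u (∀ i, G i)) := by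
    rw [hu]
    exact PairedColoring.nonempty_pi _ G fun i =>
      nonempty_pairedColoring_of_isElementaryAbelian (hG i) (hq i) (hmq i) (hcard i)
  have hu1 : 1 < u := by
    rw [hu]
    exact (Nat.one_lt_pow two_ne_zero (hq ⟨0, hs⟩).one_lt).trans_le
      (Nat.le_of_dvd (prod_pos fun i _ => pow_pos (hq i).pos 2)
        (dvd_prod_of_mem (fun i => q i ^ 2) (mem_univ _)))
  have hmu : m ∣ u - 1 := by
    rw [← Nat.modEq_iff_dvd' hu1.le, hu]
    refine (Nat.ModEq.symm ?_)
    have h : ∀ i ∈ (univ : Finset (Fin s)), q i ^ 2 ≡ 1 [MOD m] := by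
      intro i _
      have h1 : 1 ≤ q i ^ 2 := Nat.one_le_pow _ _ (hq i).pos
      refine (Nat.ModEq.symm ((Nat.modEq_iff_dvd' h1).2 ?_))
      have h2 : q i ^ 2 - 1 = (q i + 1) * (q i - 1) := by simpa using Nat.sq_sub_sq (q i) 1
      rw [h2]
      exact ((dvd_mul_left m 2).trans (hmq i)).mul_right _
    have h3 : ∏ i, q i ^ 2 ≡ ∏ _i : Fin s, 1 [MOD m] := Nat.ModEq.prod h
    simpa using h3
  let T : ZMod m → ZMod m → Set (∀ i, G i) := fun y₁ y₂ => S.colorClass (y₂ - y₁) {y₁}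
  have hT : ∀ d y, T y (y + d) = S.colorClass d {y} := by
    intro d y
    simp only [T, add_sub_cancel_left]
  have hunion : ∀ (d : ZMod m) (Y : Finset (ZMod m)),
      (⋃ y ∈ (Y : Set (ZMod m)), T y (y + d)) = S.colorClass d Y := by
    intro d Y
    ext x
    simp [hT, PairedColoring.colorClass]
  have hclass := S.isLatinSquareConnectionSet_colorClass hu1 hmu
  refine ⟨hmu, T, fun y₁ y₂ => ?_, fun d => ⟨fun y y' hne => ?_, ?_⟩, fun i j hi hj => ?_,
    fun i j hi hj => ?_⟩
  · have h := hclass (y₂ - y₁) {y₁}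
    have h1 : (0 ∈ ({y₁} : Finset (ZMod m))) ↔ y₁ = 0 := by rw [mem_singleton, eq_comm]
    have h2 : (-(y₂ - y₁) ∈ ({y₁} : Finset (ZMod m))) ↔ y₂ = 0 := by
      rw [mem_singleton, neg_sub, sub_eq_self]
    simpa only [card_singleton, one_mul, h1, h2] using h
  · change Disjoint (T y (y + d)) (T y' (y' + d))
    rw [hT, hT, Set.disjoint_left]
    intro x hx hx'
    exact hne ((mem_singleton.1 hx.2).symm.trans (mem_singleton.1 hx'.2))
  · ext x
    simp [hT, PairedColoring.colorClass]
  · -- for `y₂ = 1` the exceptional colours `0` and `-1` are distinct; `Y` contains `j` of them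
    have hm2 : Fact (1 < m) := ⟨by omega⟩
    have hne : (0 : ZMod m) ∉ ({-1} : Finset (ZMod m)) := by simp
    obtain ⟨Y, hY, hYj⟩ := exists_finset_card_eq_inter ({0, -1} : Finset (ZMod m)) (i := i) (j := j)
      (by rw [card_insert_of_notMem hne, card_singleton]; exact hj)
      (by rw [card_insert_of_notMem hne, card_singleton, ZMod.card]; exact hi)
    refine ⟨1, Y, ?_⟩
    rw [hunion]
    have hcount : (if (0 : ZMod m) ∈ Y then 1 else 0) + (if (-1 : ZMod m) ∈ Y then 1 else 0) = j := by
      rw [← hYj, ← filter_mem_eq_inter, card_filter, sum_insert hne, sum_singleton]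
    have h := hclass 1 Y
    rwa [add_assoc, hcount, hY] at h
  · -- for `y₂ = 0` the exceptional colours coincide, so that `0` contributes twice
    obtain ⟨Y, hY, hYj⟩ := exists_finset_card_eq_inter ({0} : Finset (ZMod m)) (i := i) (j := j)
      (by rw [card_singleton]; exact hj) (by rw [card_singleton, ZMod.card]; exact hi)
    refine ⟨0, Y, ?_⟩
    rw [hunion]
    have hcount : (if (0 : ZMod m) ∈ Y then 1 else 0) = j := by
      rw [← hYj, ← filter_mem_eq_inter, card_filter, sum_singleton]
    have h := hclass 0 Y
    rwa [neg_zero, add_assoc, hcount, hY, ← two_mul, add_comm i j] at h
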